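/- Let $a>0$, $b<0$ and $\varepsilon\neq 0$ be real numbers, and for $d=(d_1,\dots,d_6)\in\mathbb{R}^6$ consider the planar system $$\dot x=y,\qquad \dot y=-x-\frac{2b}{a^2}x^3+\varepsilon\,(d_3+d_2x^2+d_1x^4+d_4y^2+d_5x^6+d_6y^4)\,y ,$$ which for $d=0$ is Hamiltonian with a center at the origin. Then at least five limit cycles can bifurcate from this center: for every neighbourhood $U$ of the origin in $\mathbb{R}^2$ and every neighbourhood $W$ of $0$ in $\mathbb{R}^6$ there is $d\in W$ such that the system with coefficients $d$ has at least five limit cycles contained in $U$. Here a limit cycle is a periodic orbit (of a non-constant periodic solution) having a neighbourhood that contains no other periodic orbit. -/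

import Mathlib

open Topology

/-- The vector field on the plane of the system
`x' = y`, `y' = -x - (2b/a²) x³ + ε Q₁(x, y)` with
`Q₁(x, y) = (d₃ + d₂ x² + d₁ x⁴ + d₄ y² + d₅ x⁶ + d₆ y⁴) y`.
The coefficients `(d₁, …, d₆)` are `(d 0, …, d 5)`. -/
noncomputable def rayleighLienardField (a b ε : ℝ) (d : Fin 6 → ℝ) (p : ℝ × ℝ) : ℝ × ℝ :=
  (p.2,
    -p.1 - 2 * b / a ^ 2 * p.1 ^ 3
      + ε * ((d 2 + d 1 * p.1 ^ 2 + d 0 * p.1 ^ 4 + d 3 * p.2 ^ 2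
          + d 4 * p.1 ^ 6 + d 5 * p.2 ^ 4) * p.2))

/-- `Γ` is a periodic orbit of the autonomous planar vector field `X`: the trace of a
non-constant periodic solution defined for all times. -/
def IsPeriodicOrbit (X : ℝ × ℝ → ℝ × ℝ) (Γ : Set (ℝ × ℝ)) : Prop :=
  ∃ (γ : ℝ → ℝ × ℝ) (T : ℝ), 0 < T ∧ IsIntegralCurve γ (fun _ => X) ∧
    Function.Periodic γ T ∧ (∃ t, γ t ≠ γ 0) ∧ Γ = Set.range γ

/-- A limit cycle is a periodic orbit that is isolated among the periodic orbits: some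
neighbourhood of it contains no other periodic orbit. -/
def IsLimitCycle (X : ℝ × ℝ → ℝ × ℝ) (Γ : Set (ℝ × ℝ)) : Prop :=
  IsPeriodicOrbit X Γ ∧
    ∃ U : Set (ℝ × ℝ), IsOpen U ∧ Γ ⊆ U ∧
      ∀ Γ' : Set (ℝ × ℝ), IsPeriodicOrbit X Γ' → Γ' ⊆ U → Γ' = Γ

/-- In the family `X` of planar vector fields, at least `k` limit cycles bifurcate from the
point `p` at the parameter value `l₀`: in every neighbourhood of `p`, and for parameter values
arbitrarily close to `l₀`, there are at least `k` limit cycles. -/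
def LimitCyclesBifurcate {L : Type*} [TopologicalSpace L] (X : L → ℝ × ℝ → ℝ × ℝ)
    (l₀ : L) (p : ℝ × ℝ) (k : ℕ) : Prop :=
  ∀ U ∈ 𝓝 p, ∀ W ∈ 𝓝 l₀, ∃ l ∈ W,
    (k : ℕ∞) ≤ {Γ : Set (ℝ × ℝ) | IsLimitCycle (X l) Γ ∧ Γ ⊆ U}.encard

/-! Put c = -2b/a² > 0 and scale the plane by √(η/c). The system becomes the oscillator x' = y, y' =
-x + ηx³ + (η⁴D + η¹¹P)y with D = `exactDamping` and P = `unfoldingDamping`, and circles of fixed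
radius in the new plane shrink to the origin as η → 0.

Along x' = y, y' = -x + ηx³ the function Dy² is the derivative of xy³, so one combination of the six
damping terms is invisible to first-order averaging, which leaves only five effective parameters.
The second-order effect of D is again a derivative (`secondCorrection_identity`), but its
third-order effect, of size η¹², is not. P, of size η¹¹, is tuned against that effect so that, up to
exact derivatives, their sum is η¹⁴F(x² + y²) plus smaller terms, where F = `averagedRate` has the
simple zeros 1, …, 5 (`thirdCorrection_identity`, `correctedEnergy_derivative`).

Each simple zero u of F yields a limit cycle near x² + y² = u (`eventually_exists_isLimitCycle`).
With the polar angle as independent variable, the corrected energy V rises and falls in opposite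
ways near the two edges of a thin annulus, so the return map has a fixed point by the intermediate
value theorem. Isolation follows because the rate of V per unit of angle, divided by its scale
factor, is strictly increasing in the radius. -/

open Set Filter Real Function

/-! ### Scalar equations with periodic coefficients. -/

/-- Solutions of a slow scalar equation exist up to time `T`, move by at most `κ / 2`, and their
value at time `T` depends continuously on the initial value. -/
theorem exists_solution_map {f : ℝ → ℝ → ℝ} {ρ₀ κ T M : ℝ} (hκ : 0 < κ) (hT : 0 < T)
    (hc : ∀ ρ ∈ Icc (ρ₀ - 2 * κ) (ρ₀ + 2 * κ), Continuous fun θ => f θ ρ)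
    (hL : ∀ θ, LipschitzOnWith 1 (f θ) (Icc (ρ₀ - 2 * κ) (ρ₀ + 2 * κ)))
    (hb : ∀ θ, ∀ ρ ∈ Icc (ρ₀ - 2 * κ) (ρ₀ + 2 * κ), |f θ ρ| ≤ M) (hM : M * T ≤ κ / 2) :
    ∃ α : ℝ → ℝ → ℝ, ContinuousOn (fun ρ => α ρ T) (Icc (ρ₀ - κ) (ρ₀ + κ)) ∧
      ∀ ρ ∈ Icc (ρ₀ - κ) (ρ₀ + κ), α ρ 0 = ρ ∧ ∀ t ∈ Icc 0 T,
        HasDerivWithinAt (α ρ) (f t (α ρ t)) (Icc 0 T) t ∧ |α ρ t - ρ| ≤ κ / 2 := by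
  have hI : ρ₀ - 2 * κ ≤ ρ₀ + 2 * κ := by linarith
  -- The clamped field is bounded by `M` everywhere, so the drift bound is available before the
  -- solution is known to stay in the interval. That bound then shows the clamp to be inactive.
  set c : ℝ → ℝ := fun ρ => (projIcc _ _ hI ρ : ℝ) with hcdef
  have hcmem : ∀ ρ, c ρ ∈ Icc (ρ₀ - 2 * κ) (ρ₀ + 2 * κ) := fun ρ => (projIcc _ _ hI ρ).2
  have hM0 : 0 ≤ M := (abs_nonneg _).trans (hb 0 ρ₀ ⟨by linarith, by linarith⟩)
  have hcL : LipschitzWith 1 c := LipschitzWith.projIcc hI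
  have hpl : IsPicardLindelof (fun t ρ => f t (c ρ)) (tmin := 0) (tmax := T)
      ⟨0, left_mem_Icc.2 hT.le⟩ ρ₀ (2 * κ).toNNReal κ.toNNReal M.toNNReal 1 := by
    refine ⟨fun t _ => ?_, fun x _ => (hc _ (hcmem x)).continuousOn, fun t _ x _ => ?_, ?_⟩
    · have := (hL t).comp (hcL.lipschitzOnWith (s := Metric.closedBall ρ₀ ((2 * κ).toNNReal)))
        (fun x _ => hcmem x)
      simpa [Function.comp_def] using this
    · rw [Real.coe_toNNReal _ hM0]
      exact hb t _ (hcmem x)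
    · rw [Real.coe_toNNReal _ hM0, Real.coe_toNNReal _ (by linarith), Real.coe_toNNReal _ hκ.le]
      simp only [sub_zero, sub_self]
      rw [max_eq_left hT.le]
      linarith
  obtain ⟨α, h1, L', h2⟩ := hpl.exists_forall_mem_closedBall_eq_hasDerivWithinAt_lipschitzOnWith
  have hball : Metric.closedBall ρ₀ (κ.toNNReal : ℝ) = Icc (ρ₀ - κ) (ρ₀ + κ) := by
    rw [Real.coe_toNNReal _ hκ.le, Real.closedBall_eq_Icc]
  rw [hball] at h1 h2
  refine ⟨α, (h2 T (right_mem_Icc.2 hT.le)).continuousOn, fun ρ hρ => ⟨(h1 ρ hρ).1, fun t ht => ?_⟩⟩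
  have hd := (h1 ρ hρ).2
  have h0 : α ρ 0 = ρ := (h1 ρ hρ).1
  have hbd : |α ρ t - ρ| ≤ κ / 2 := by
    have := (convex_Icc (0 : ℝ) T).norm_image_sub_le_of_norm_hasDerivWithin_le
      (f := α ρ) (C := M) hd (fun x _ => hb x _ (hcmem _)) (left_mem_Icc.2 hT.le) ht
    rw [h0, sub_zero, Real.norm_eq_abs, Real.norm_eq_abs, abs_of_nonneg ht.1] at this
    exact this.trans ((mul_le_mul_of_nonneg_left ht.2 hM0).trans hM)
  refine ⟨?_, hbd⟩
  have hmem : α ρ t ∈ Icc (ρ₀ - 2 * κ) (ρ₀ + 2 * κ) := by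
    have := abs_le.1 hbd
    exact ⟨by linarith [hρ.1], by linarith [hρ.2]⟩
  have : c (α ρ t) = α ρ t := by
    simp only [hcdef, projIcc_of_mem hI hmem]
  have h3 := hd t ht
  rwa [this] at h3

/-- A solution on one period of a periodic equation that returns to its initial value extends to a
global periodic solution. -/
theorem exists_periodic_extension {f : ℝ → ℝ → ℝ} {α : ℝ → ℝ} {T : ℝ} (hT : 0 < T)
    (hper : ∀ θ ρ, f (θ + T) ρ = f θ ρ)
    (hα : ∀ t ∈ Icc 0 T, HasDerivWithinAt α (f t (α t)) (Icc 0 T) t) (h0 : α 0 = α T) :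
    ∃ β : ℝ → ℝ, Periodic β T ∧ (∀ t ∈ Icc 0 T, β t = α t) ∧
      ∀ t, HasDerivAt β (f t (β t)) t := by
  set β : ℝ → ℝ := fun t => α (toIcoMod hT 0 t) with hβ
  have hβper : Periodic β T := fun t => by simp [hβ]
  have hIco : ∀ t ∈ Ico 0 T, β t = α t := fun t ht => by
    simp only [hβ]
    rw [(toIcoMod_eq_self hT).2 (by simpa using ht)]
  have hIcc : ∀ t ∈ Icc 0 T, β t = α t := fun t ht => by
    rcases eq_or_lt_of_le ht.2 with h | h
    · rw [h, ← h0, ← hIco 0 ⟨le_rfl, hT⟩]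
      simpa using hβper 0
    · exact hIco t ⟨ht.1, h⟩
  have hwithin : ∀ t ∈ Icc 0 T, HasDerivWithinAt β (f t (β t)) (Icc 0 T) t := fun t ht => by
    rw [hIcc t ht]
    exact (hα t ht).congr hIcc (hIcc t ht)
  have hshift : ∀ t n, HasDerivAt β (f t (β t)) t → n = T ∨ n = -T →
      HasDerivAt β (f (t + n) (β (t + n))) (t + n) := by
    intro t n h hn
    have hβn : ∀ s, β (s - n) = β s := by
      rcases hn with rfl | rfl
      · exact fun s => hβper.sub_eq s
      · exact fun s => by rw [sub_neg_eq_add]; exact hβper s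
    have hfn : ∀ ρ, f (t + n) ρ = f t ρ := by
      rcases hn with rfl | rfl
      · exact hper t
      · intro ρ
        rw [← hper (t + -T) ρ]
        congr 1; ring
    have e1 : β (t + n) = β t := by rw [← hβn (t + n)]; congr 1; ring
    rw [e1, hfn]
    have h' : HasDerivAt β (f t (β t)) (t + n - n) := by simpa using h
    have := h'.comp_sub_const (t + n) n
    simpa [hβn] using this
  have hbase : ∀ t ∈ Ico 0 T, HasDerivAt β (f t (β t)) t := by
    intro t ht
    rcases eq_or_lt_of_le ht.1 with h | h
    · subst h
      have hr : HasDerivWithinAt β (f 0 (β 0)) (Ici 0) 0 :=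
        (hwithin 0 ⟨le_rfl, hT.le⟩).mono_of_mem_nhdsWithin (Icc_mem_nhdsGE hT)
      have hl : HasDerivWithinAt β (f T (β T)) (Iic T) T :=
        (hwithin T ⟨hT.le, le_rfl⟩).mono_of_mem_nhdsWithin (Icc_mem_nhdsLE hT)
      have hβT : β T = β 0 := by simpa using hβper 0
      have hfT : f T (β T) = f 0 (β 0) := by
        rw [hβT]; simpa using hper 0 (β 0)
      -- The left derivative at the seam is the one at `T`, carried back by periodicity.
      have hl0 : HasDerivWithinAt β (f 0 (β 0)) (Iic 0) 0 := by
        rw [hfT] at hl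
        have hg : HasDerivWithinAt (fun s : ℝ => s + T) 1 (Iic 0) 0 :=
          ((hasDerivAt_id (0 : ℝ)).add_const T).hasDerivWithinAt
        have hl' : HasDerivWithinAt β (f 0 (β 0)) (Iic T) ((fun s : ℝ => s + T) 0) := by
          simpa using hl
        have := hl'.comp (0 : ℝ) hg (fun s hs => by simpa using hs)
        have hcomp : β ∘ (fun s : ℝ => s + T) = β := funext fun s => hβper s
        rwa [hcomp, mul_one] at this
      have := hl0.union hr
      rwa [Iic_union_Ici, hasDerivWithinAt_univ] at this
    · exact (hwithin t ⟨ht.1, ht.2.le⟩).hasDerivAt (Icc_mem_nhds h ht.2)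
  refine ⟨β, hβper, hIcc, fun t => ?_⟩
  have hup : ∀ n : ℕ, ∀ s, HasDerivAt β (f s (β s)) s →
      HasDerivAt β (f (s + n * T) (β (s + n * T))) (s + n * T) := by
    intro n
    induction n with
    | zero => intro s hs; simpa using hs
    | succ n ih =>
      intro s hs
      have := hshift _ T (ih s hs) (Or.inl rfl)
      have e : s + ((n + 1 : ℕ) : ℝ) * T = s + n * T + T := by push_cast; ring
      rwa [e]
  have hdown : ∀ n : ℕ, ∀ s, HasDerivAt β (f s (β s)) s →
      HasDerivAt β (f (s - n * T) (β (s - n * T))) (s - n * T) := by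
    intro n
    induction n with
    | zero => intro s hs; simpa using hs
    | succ n ih =>
      intro s hs
      have := hshift _ (-T) (ih s hs) (Or.inr rfl)
      have e : s - ((n + 1 : ℕ) : ℝ) * T = s - n * T + -T := by push_cast; ring
      rwa [e]
  have hs := hbase _ (by simpa using toIcoMod_mem_Ico hT 0 t)
  have ht : toIcoMod hT 0 t + toIcoDiv hT 0 t * T = t := by
    simp [← zsmul_eq_mul]
  rcases Int.eq_nat_or_neg (toIcoDiv hT 0 t) with ⟨n, hn | hn⟩
  · have := hup n _ hs
    rw [hn] at ht
    push_cast at ht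
    rwa [ht] at this
  · have := hdown n _ hs
    rw [hn] at ht
    push_cast at ht
    have e : toIcoMod hT 0 t - n * T = t := by linarith
    rwa [e] at this

/-! ### Polar coordinates for perturbations of the harmonic oscillator. -/

/-- The point of the plane with clockwise angle `θ` and logarithmic radius `ρ`. -/
noncomputable def polarPt (θ ρ : ℝ) : ℝ × ℝ := (exp ρ * cos θ, -(exp ρ * sin θ))

/-- The planar field of the perturbed harmonic oscillator `x' = y`, `y' = -x + e(x, y)`. -/
def oscField (e : ℝ × ℝ → ℝ) (p : ℝ × ℝ) : ℝ × ℝ := (p.2, -p.1 + e p)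

/-- The derivative of the logarithmic radius along `oscField e`. -/
noncomputable def radSpeed (e : ℝ × ℝ → ℝ) (θ ρ : ℝ) : ℝ :=
  -(sin θ * exp (-ρ) * e (polarPt θ ρ))

/-- The derivative of the clockwise angle along `oscField e`. -/
noncomputable def angSpeed (e : ℝ × ℝ → ℝ) (θ ρ : ℝ) : ℝ :=
  1 - cos θ * exp (-ρ) * e (polarPt θ ρ)

theorem polarPt_sq (θ ρ : ℝ) : (polarPt θ ρ).1 ^ 2 + (polarPt θ ρ).2 ^ 2 = exp ρ ^ 2 := by
  simp only [polarPt]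
  linear_combination exp ρ ^ 2 * sin_sq_add_cos_sq θ

theorem polarPt_add_two_pi (θ ρ : ℝ) : polarPt (θ + 2 * π) ρ = polarPt θ ρ := by
  simp [polarPt]

theorem radSpeed_add_two_pi (e : ℝ × ℝ → ℝ) (θ ρ : ℝ) :
    radSpeed e (θ + 2 * π) ρ = radSpeed e θ ρ := by
  simp [radSpeed, polarPt_add_two_pi]

theorem angSpeed_add_two_pi (e : ℝ × ℝ → ℝ) (θ ρ : ℝ) :
    angSpeed e (θ + 2 * π) ρ = angSpeed e θ ρ := by
  simp [angSpeed, polarPt_add_two_pi]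

/-- The factor `c` allows any speed along the orbit: `c = 1` is the time parametrization, `c = 1 /
angSpeed` the parametrization by angle. -/
theorem hasDerivAt_polarPt {e : ℝ × ℝ → ℝ} {φ ρ : ℝ → ℝ} {t c : ℝ}
    (hφ : HasDerivAt φ (c * angSpeed e (φ t) (ρ t)) t)
    (hρ : HasDerivAt ρ (c * radSpeed e (φ t) (ρ t)) t) :
    HasDerivAt (fun s => polarPt (φ s) (ρ s)) (c • oscField e (polarPt (φ t) (ρ t))) t := by
  have h := (hρ.exp.mul hφ.cos).prodMk (hρ.exp.mul hφ.sin).neg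
  refine h.congr_deriv ?_
  have hE : exp (ρ t) * exp (-ρ t) = 1 := by rw [← Real.exp_add]; simp
  have hs := sin_sq_add_cos_sq (φ t)
  simp only [radSpeed, angSpeed, oscField, Prod.smul_mk, smul_eq_mul]
  set E := e (polarPt (φ t) (ρ t))
  simp only [polarPt]
  ext
  · simp only
    linear_combination 0 * hE
  · simp only
    linear_combination (c * E * (sin (φ t) ^ 2 + cos (φ t) ^ 2)) * hE + c * E * hs

/-- An integral curve avoiding the origin has a differentiable angle and logarithmic radius. -/
theorem exists_polar_lift {e : ℝ × ℝ → ℝ} (he : Continuous e) {γ : ℝ → ℝ × ℝ}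
    (hγ : IsIntegralCurve γ (fun _ => oscField e)) (hne : ∀ t, γ t ≠ 0) :
    ∃ φ ρ : ℝ → ℝ, (∀ t, γ t = polarPt (φ t) (ρ t)) ∧
      (∀ t, HasDerivAt φ (angSpeed e (φ t) (ρ t)) t) ∧
      ∀ t, HasDerivAt ρ (radSpeed e (φ t) (ρ t)) t := by
  have hγc : Continuous γ := continuous_iff_continuousAt.2 fun t => (hγ t).continuousAt
  have hx : ∀ t, HasDerivAt (fun s => (γ s).1) (γ t).2 t := fun t =>
    (hasFDerivAt_fst (𝕜 := ℝ) (p := γ t)).comp_hasDerivAt t (hγ t)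
  have hy : ∀ t, HasDerivAt (fun s => (γ s).2) (-(γ t).1 + e (γ t)) t := fun t =>
    (hasFDerivAt_snd (𝕜 := ℝ) (p := γ t)).comp_hasDerivAt t (hγ t)
  have hr : ∀ t, 0 < (γ t).1 ^ 2 + (γ t).2 ^ 2 := fun t => by
    rcases eq_or_ne (γ t).1 0 with h | h
    · have : (γ t).2 ≠ 0 := fun h' => hne t (Prod.ext h h')
      positivity
    · positivity
  -- This is the angular speed in Cartesian terms. The angle is its integral, since `Complex.arg`
  -- jumps; the argument is used only at time 0, of the conjugate point because angles run
  -- clockwise.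
  set ω : ℝ → ℝ := fun t => 1 - (γ t).1 * e (γ t) / ((γ t).1 ^ 2 + (γ t).2 ^ 2) with hω
  have hωc : Continuous ω := by
    refine continuous_const.sub (Continuous.div (by fun_prop) (by fun_prop) fun t => (hr t).ne')
  set z : ℂ := ⟨(γ 0).1, -(γ 0).2⟩ with hz
  set φ : ℝ → ℝ := fun t => Complex.arg z + ∫ s in (0 : ℝ)..t, ω s with hφdef
  set ρ : ℝ → ℝ := fun t => Real.log ((γ t).1 ^ 2 + (γ t).2 ^ 2) / 2 with hρdef
  have hφ : ∀ t, HasDerivAt φ (ω t) t := fun t =>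
    (intervalIntegral.integral_hasDerivAt_right (hωc.intervalIntegrable _ _)
      (hωc.stronglyMeasurableAtFilter _ _) hωc.continuousAt).const_add _
  have hρ : ∀ t, HasDerivAt ρ ((γ t).2 * e (γ t) / ((γ t).1 ^ 2 + (γ t).2 ^ 2)) t := fun t => by
    have := ((((hx t).pow 2).add ((hy t).pow 2)).log (hr t).ne').div_const 2
    refine this.congr_deriv ?_
    have := (hr t).ne'
    simp only [Pi.add_apply, Pi.pow_apply]
    field_simp
    push_cast
    ring
  have hexp : ∀ t, exp (ρ t) ^ 2 = (γ t).1 ^ 2 + (γ t).2 ^ 2 := fun t => by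
    rw [← Real.exp_nat_mul]
    simp only [hρdef]
    push_cast
    rw [mul_div_cancel₀ _ (two_ne_zero), Real.exp_log (hr t)]
  -- Turning `γ` back by `φ` and dividing by the radius gives a constant vector, equal to (1, 0) at
  -- time 0. The two coordinates are treated here and in `hB`.
  have hA : ∀ t, HasDerivAt (fun s => ((γ s).1 * cos (φ s) - (γ s).2 * sin (φ s)) * exp (-ρ s))
      0 t := fun t => by
    refine ((((hx t).mul (hφ t).cos).sub ((hy t).mul (hφ t).sin)).mul (hρ t).neg.exp).congr_deriv ?_
    have := (hr t).ne'
    simp only [hω, Pi.mul_apply, Pi.sub_apply, Pi.neg_apply]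
    field_simp
    ring
  have hB : ∀ t, HasDerivAt (fun s => ((γ s).1 * sin (φ s) + (γ s).2 * cos (φ s)) * exp (-ρ s))
      0 t := fun t => by
    refine ((((hx t).mul (hφ t).sin).add ((hy t).mul (hφ t).cos)).mul (hρ t).neg.exp).congr_deriv ?_
    have := (hr t).ne'
    simp only [hω, Pi.mul_apply, Pi.add_apply, Pi.neg_apply]
    field_simp
    ring
  have hAc := fun t => is_const_of_deriv_eq_zero (fun t => (hA t).differentiableAt)
    (fun t => (hA t).deriv) t 0
  have hBc := fun t => is_const_of_deriv_eq_zero (fun t => (hB t).differentiableAt)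
    (fun t => (hB t).deriv) t 0
  have hφ0 : φ 0 = Complex.arg z := by simp [hφdef]
  have hnorm : ‖z‖ = exp (ρ 0) := by
    have h1 : ‖z‖ ^ 2 = exp (ρ 0) ^ 2 := by
      rw [hexp, ← Complex.normSq_eq_norm_sq, Complex.normSq_apply]
      simp only [hz]; ring
    exact (pow_left_inj₀ (norm_nonneg _) (exp_pos _).le two_ne_zero).1 h1
  have hx0 : (γ 0).1 = exp (ρ 0) * cos (φ 0) := by
    rw [hφ0, ← hnorm, Complex.norm_mul_cos_arg]
  have hy0 : (γ 0).2 = -(exp (ρ 0) * sin (φ 0)) := by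
    rw [hφ0, ← hnorm, Complex.norm_mul_sin_arg]; simp [hz]
  have hE : ∀ t, exp (ρ t) * exp (-ρ t) = 1 := fun t => by rw [← Real.exp_add]; simp
  have hmain : ∀ t, γ t = polarPt (φ t) (ρ t) := fun t => by
    have a1 : ((γ t).1 * cos (φ t) - (γ t).2 * sin (φ t)) * exp (-ρ t) = 1 := by
      rw [hAc t, hx0, hy0]
      linear_combination exp (ρ 0) * exp (-ρ 0) * sin_sq_add_cos_sq (φ 0) + hE 0
    have b1 : ((γ t).1 * sin (φ t) + (γ t).2 * cos (φ t)) * exp (-ρ t) = 0 := by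
      rw [hBc t, hx0, hy0]
      ring
    have hs := sin_sq_add_cos_sq (φ t)
    have a2 : (γ t).1 * cos (φ t) - (γ t).2 * sin (φ t) = exp (ρ t) := by
      linear_combination exp (ρ t) * a1 - ((γ t).1 * cos (φ t) - (γ t).2 * sin (φ t)) * hE t
    have b2 : (γ t).1 * sin (φ t) + (γ t).2 * cos (φ t) = 0 := by
      linear_combination exp (ρ t) * b1 - ((γ t).1 * sin (φ t) + (γ t).2 * cos (φ t)) * hE t
    ext
    · simp only [polarPt]
      linear_combination cos (φ t) * a2 + sin (φ t) * b2 - (γ t).1 * hs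
    · simp only [polarPt]
      linear_combination -sin (φ t) * a2 + cos (φ t) * b2 - (γ t).2 * hs
  refine ⟨φ, ρ, hmain, fun t => (hφ t).congr_deriv ?_, fun t => (hρ t).congr_deriv ?_⟩
  · simp only [hω, angSpeed, ← hmain t, ← hexp t]
    have : (γ t).1 = exp (ρ t) * cos (φ t) := by rw [hmain t]; rfl
    rw [this, Real.exp_neg]
    have := (exp_pos (ρ t)).ne'
    field_simp
  · simp only [radSpeed, ← hmain t, ← hexp t]
    have : (γ t).2 = -(exp (ρ t) * sin (φ t)) := by rw [hmain t]; rfl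
    rw [this, Real.exp_neg]
    have := (exp_pos (ρ t)).ne'
    field_simp

theorem eq_and_exists_of_polarPt_eq {θ θ' ρ ρ' : ℝ} (h : polarPt θ ρ = polarPt θ' ρ') :
    ρ = ρ' ∧ ∃ k : ℤ, θ = θ' + k * (2 * π) := by
  have hsq : exp ρ ^ 2 = exp ρ' ^ 2 := by rw [← polarPt_sq θ, ← polarPt_sq θ', h]
  have hρ : ρ = ρ' := exp_injective
    ((pow_left_inj₀ (exp_pos _).le (exp_pos _).le two_ne_zero).1 hsq)
  subst hρ
  simp only [polarPt, Prod.mk.injEq, neg_inj] at h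
  have hc := mul_left_cancel₀ (exp_pos ρ).ne' h.1
  have hs := mul_left_cancel₀ (exp_pos ρ).ne' h.2
  obtain ⟨k, hk⟩ := Real.Angle.angle_eq_iff_two_pi_dvd_sub.1 (Real.Angle.cos_sin_inj hc hs)
  exact ⟨rfl, k, by linarith⟩

/-! ### Passing between angle and time. -/

theorem surjective_of_half_le_deriv {h h' : ℝ → ℝ} (hd : ∀ t, HasDerivAt h (h' t) t)
    (hpos : ∀ t, 1 / 2 ≤ h' t) : Surjective h := by
  have hm : Monotone fun t => h t - t / 2 := by
    refine monotone_of_deriv_nonneg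
      (fun t => ((hd t).sub ((hasDerivAt_id t).div_const 2)).differentiableAt) fun t => ?_
    have := ((hd t).sub ((hasDerivAt_id t).div_const 2)).deriv
    rw [show (fun t => h t - t / 2) = h - fun t => id t / 2 from rfl, this]
    linarith [hpos t]
  refine Continuous.surjective (continuous_iff_continuousAt.2 fun t => (hd t).continuousAt) ?_ ?_
  · refine tendsto_atTop_mono' atTop (f₁ := fun t => t / 2 + h 0) ?_ ?_
    · filter_upwards [eventually_ge_atTop 0] with t ht
      have := hm ht
      simp only at this
      linarith
    · exact tendsto_atTop_add_const_right _ _ (tendsto_id.atTop_div_const two_pos)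
  · refine tendsto_atBot_mono' atBot (f₁ := fun t => t / 2 + h 0) ?_ ?_
    · filter_upwards [eventually_le_atBot 0] with t ht
      have := hm ht
      simp only at this
      linarith
    · exact tendsto_atBot_add_const_right _ _ (tendsto_id.atBot_div_const two_pos)

/-- The time needed to reach angle θ is the integral of 1/B; its inverse is the angle as a function
of time, and periodicity of `B` makes every turn last equally long. -/
theorem exists_time_parametrization {B : ℝ → ℝ} {P : ℝ} (hBc : Continuous B) (hP : 0 < P)
    (hB : ∀ θ, 1 / 2 < B θ ∧ B θ < 2) (hper : Periodic B P) :
    ∃ (φ : ℝ → ℝ) (T : ℝ), 0 < T ∧ Surjective φ ∧ (∀ t, HasDerivAt φ (B (φ t)) t) ∧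
      ∀ t, φ (t + T) = φ t + P := by
  have hB0 : ∀ θ, B θ ≠ 0 := fun θ => by linarith [(hB θ).1]
  have hc : Continuous fun θ => (B θ)⁻¹ := hBc.inv₀ hB0
  set τ : ℝ → ℝ := fun θ => ∫ s in (0 : ℝ)..θ, (B s)⁻¹ with hτdef
  have hτ : ∀ θ, HasDerivAt τ (B θ)⁻¹ θ := fun θ =>
    intervalIntegral.integral_hasDerivAt_right (hc.intervalIntegrable _ _)
      (hc.stronglyMeasurableAtFilter _ _) hc.continuousAt
  have hpos : ∀ θ, 1 / 2 ≤ (B θ)⁻¹ := fun θ => by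
    rw [one_div]
    exact inv_anti₀ (by linarith [(hB θ).1]) (hB θ).2.le
  have hmono : StrictMono τ := strictMono_of_deriv_pos fun θ => by
    rw [(hτ θ).deriv]; linarith [hpos θ]
  have hsurj := surjective_of_half_le_deriv hτ hpos
  set Φ := hmono.orderIsoOfSurjective τ hsurj with hΦ
  have hΦτ : ∀ t, τ (Φ.symm t) = t := fun t => Φ.apply_symm_apply t
  have hτΦ : ∀ θ, Φ.symm (τ θ) = θ := fun θ => Φ.symm_apply_apply θ
  have hτP : ∀ θ, τ (θ + P) = τ θ + τ P := by
    intro θ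
    have hd : ∀ θ, HasDerivAt (fun θ => τ (θ + P) - τ θ) 0 θ := fun θ => by
      have := ((hτ (θ + P)).comp_add_const θ P).sub (hτ θ)
      rwa [hper θ, sub_self] at this
    have := is_const_of_deriv_eq_zero (fun t => (hd t).differentiableAt)
      (fun t => (hd t).deriv) θ 0
    simp only [zero_add] at this
    have h0 : τ 0 = 0 := by simp [hτdef]
    linarith
  refine ⟨Φ.symm, τ P, ?_, Φ.symm.surjective, fun t => ?_, fun t => ?_⟩
  · have : τ 0 = 0 := by simp [hτdef]
    rw [← this]
    exact hmono hP
  · have := HasDerivAt.of_local_left_inverse (Φ.symm.continuous.continuousAt (x := t))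
      (hτ (Φ.symm t)) (inv_ne_zero (hB0 _)) (Eventually.of_forall hΦτ)
    rwa [inv_inv] at this
  · rw [← hτΦ (Φ.symm t + P), hτP, hΦτ]

theorem hasDerivAt_along_angle {e V g : ℝ × ℝ → ℝ}
    (hV : ∀ p, ∃ V' : ℝ × ℝ →L[ℝ] ℝ, HasFDerivAt V V' p ∧ V' (oscField e p) = g p)
    {φ ρ : ℝ → ℝ} {t c : ℝ} (hφ : HasDerivAt φ (c * angSpeed e (φ t) (ρ t)) t)
    (hρ : HasDerivAt ρ (c * radSpeed e (φ t) (ρ t)) t) :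
    HasDerivAt (fun s => V (polarPt (φ s) (ρ s))) (c * g (polarPt (φ t) (ρ t))) t := by
  obtain ⟨V', h1, h2⟩ := hV (polarPt (φ t) (ρ t))
  have := h1.comp_hasDerivAt t (hasDerivAt_polarPt hφ hρ)
  refine this.congr_deriv ?_
  rw [map_smul, h2, smul_eq_mul]

theorem continuous_polarPt : Continuous fun q : ℝ × ℝ => polarPt q.1 q.2 := by
  unfold polarPt
  fun_prop

/-! ### Existence and isolation of a periodic orbit in an annulus. -/

section

variable {e V g : ℝ × ℝ → ℝ} {ρ₀ κ : ℝ}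

/-- If `V` increases along solutions near the outer circle and decreases near the inner one, the
return map has a fixed point in the annulus. -/
theorem exists_periodic_polar_solution (he : Continuous e)
    (hV : ∀ p, ∃ V' : ℝ × ℝ →L[ℝ] ℝ, HasFDerivAt V V' p ∧ V' (oscField e p) = g p)
    (hκ : 0 < κ)
    (hB : ∀ θ, ∀ ρ ∈ Icc (ρ₀ - 2 * κ) (ρ₀ + 2 * κ), 1 / 2 < angSpeed e θ ρ ∧ angSpeed e θ ρ < 2)
    (hf : ∀ θ, ∀ ρ ∈ Icc (ρ₀ - 2 * κ) (ρ₀ + 2 * κ),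
      |radSpeed e θ ρ / angSpeed e θ ρ| ≤ κ / 16)
    (hL : ∀ θ, LipschitzOnWith 1 (fun ρ => radSpeed e θ ρ / angSpeed e θ ρ)
      (Icc (ρ₀ - 2 * κ) (ρ₀ + 2 * κ)))
    (hpos : ∀ θ, ∀ ρ ∈ Icc (ρ₀ + κ / 2) (ρ₀ + 2 * κ), 0 < g (polarPt θ ρ))
    (hneg : ∀ θ, ∀ ρ ∈ Icc (ρ₀ - 2 * κ) (ρ₀ - κ / 2), g (polarPt θ ρ) < 0)
    (hinj : InjOn (fun ρ => V (polarPt 0 ρ)) (Icc (ρ₀ - 2 * κ) (ρ₀ + 2 * κ))) :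
    ∃ β : ℝ → ℝ, Periodic β (2 * π) ∧ (∀ θ, β θ ∈ Ioo (ρ₀ - 2 * κ) (ρ₀ + 2 * κ)) ∧
      ∀ θ, HasDerivAt β (radSpeed e θ (β θ) / angSpeed e θ (β θ)) θ := by
  have hVc : Continuous V := continuous_iff_continuousAt.2 fun p => by
    obtain ⟨V', h, _⟩ := hV p
    exact h.continuousAt
  have hT : 0 < 2 * π := by positivity
  have hcont : ∀ ρ ∈ Icc (ρ₀ - 2 * κ) (ρ₀ + 2 * κ),
      Continuous fun θ => radSpeed e θ ρ / angSpeed e θ ρ := fun ρ hρ => by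
    have h1 : Continuous fun θ => polarPt θ ρ := by unfold polarPt; fun_prop
    refine Continuous.div ?_ ?_ fun θ => by linarith [(hB θ ρ hρ).1]
    · unfold radSpeed; fun_prop
    · unfold angSpeed; fun_prop
  -- Over one turn the drift is at most (κ/16)·2π ≤ κ/2, because π ≤ 4.
  obtain ⟨α, hαc, hα⟩ := exists_solution_map hκ hT hcont hL hf (by nlinarith [pi_le_four])
  have hmem : ∀ ρ ∈ Icc (ρ₀ - κ) (ρ₀ + κ), ∀ t ∈ Icc 0 (2 * π),
      α ρ t ∈ Ioo (ρ₀ - 2 * κ) (ρ₀ + 2 * κ) := fun ρ hρ t ht => by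
    have := abs_le.1 ((hα ρ hρ).2 t ht).2
    exact ⟨by linarith [hρ.1], by linarith [hρ.2]⟩
  have hud : ∀ ρ ∈ Icc (ρ₀ - κ) (ρ₀ + κ), ∀ t ∈ Ioo 0 (2 * π),
      HasDerivAt (fun s => V (polarPt s (α ρ s)))
        ((angSpeed e t (α ρ t))⁻¹ * g (polarPt t (α ρ t))) t := fun ρ hρ t ht => by
    have ht' := Ioo_subset_Icc_self ht
    have hb := (hB t _ (Ioo_subset_Icc_self (hmem ρ hρ t ht'))).1
    have hd := ((hα ρ hρ).2 t ht').1.hasDerivAt (Icc_mem_nhds ht.1 ht.2)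
    refine hasDerivAt_along_angle hV (φ := fun s => s) (ρ := α ρ) ?_ ?_
    · rw [inv_mul_cancel₀ (by linarith)]
      exact hasDerivAt_id t
    · rw [inv_mul_eq_div]
      exact hd
  have huc : ∀ ρ ∈ Icc (ρ₀ - κ) (ρ₀ + κ),
      ContinuousOn (fun s => V (polarPt s (α ρ s))) (Icc 0 (2 * π)) := fun ρ hρ => by
    have h1 : ContinuousOn (α ρ) (Icc 0 (2 * π)) :=
      fun t ht => ((hα ρ hρ).2 t ht).1.continuousWithinAt
    exact (hVc.comp continuous_polarPt).comp_continuousOn (continuousOn_id.prodMk h1)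
  have hend : ∀ ρ, polarPt (2 * π) ρ = polarPt 0 ρ := fun ρ => by
    simpa using polarPt_add_two_pi 0 ρ
  have h0mem : (0 : ℝ) ∈ Icc 0 (2 * π) := ⟨le_rfl, hT.le⟩
  have hTmem : 2 * π ∈ Icc 0 (2 * π) := ⟨hT.le, le_rfl⟩
  -- Starting at `ρ₀ + κ` and drifting by at most `κ / 2`, the solution stays where `g` is positive.
  have hup : V (polarPt 0 (ρ₀ + κ)) < V (polarPt 0 (α (ρ₀ + κ) (2 * π))) := by
    have hρ : ρ₀ + κ ∈ Icc (ρ₀ - κ) (ρ₀ + κ) := ⟨by linarith, le_rfl⟩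
    have := strictMonoOn_of_deriv_pos (convex_Icc _ _) (huc _ hρ) (fun t ht => by
      rw [interior_Icc] at ht
      have ht' := Ioo_subset_Icc_self ht
      have hm := hmem _ hρ t ht'
      have := abs_le.1 ((hα _ hρ).2 t ht').2
      rw [(hud _ hρ t ht).deriv]
      exact mul_pos (inv_pos.2 (by linarith [(hB t _ (Ioo_subset_Icc_self hm)).1]))
        (hpos _ _ ⟨by linarith, hm.2.le⟩)) h0mem hTmem hT
    simpa only [hend, (hα _ hρ).1] using this
  have hdown : V (polarPt 0 (α (ρ₀ - κ) (2 * π))) < V (polarPt 0 (ρ₀ - κ)) := by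
    have hρ : ρ₀ - κ ∈ Icc (ρ₀ - κ) (ρ₀ + κ) := ⟨le_rfl, by linarith⟩
    have := strictAntiOn_of_deriv_neg (convex_Icc _ _) (huc _ hρ) (fun t ht => by
      rw [interior_Icc] at ht
      have ht' := Ioo_subset_Icc_self ht
      have hm := hmem _ hρ t ht'
      have := abs_le.1 ((hα _ hρ).2 t ht').2
      rw [(hud _ hρ t ht).deriv]
      exact mul_neg_of_pos_of_neg
        (inv_pos.2 (by linarith [(hB t _ (Ioo_subset_Icc_self hm)).1]))
        (hneg _ _ ⟨hm.1.le, by linarith⟩)) h0mem hTmem hT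
    simpa only [hend, (hα _ hρ).1] using this
  have hvc : Continuous fun ρ => V (polarPt 0 ρ) :=
    hVc.comp (continuous_polarPt.comp (continuous_const.prodMk continuous_id))
  -- The displacement is measured by `V`, whose monotonicity is what is known at the two edges.
  -- Injectivity of `V` on the ray turns its zero into a fixed point, whether `V` increases or
  -- decreases with the radius.
  have hDc : ContinuousOn (fun ρ => V (polarPt 0 (α ρ (2 * π))) - V (polarPt 0 ρ))
      (Icc (ρ₀ - κ) (ρ₀ + κ)) :=
    (hvc.comp_continuousOn hαc).sub hvc.continuousOn
  obtain ⟨ρ, hρ, hzero⟩ := intermediate_value_Icc (by linarith) hDc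
    (show (0 : ℝ) ∈ Icc _ _ from ⟨by linarith, by linarith⟩)
  have hfix : α ρ (2 * π) = ρ := hinj (Ioo_subset_Icc_self (hmem ρ hρ _ hTmem))
    ⟨by linarith [hρ.1], by linarith [hρ.2]⟩ (sub_eq_zero.1 hzero)
  obtain ⟨β, hβ1, hβ2, hβ3⟩ := exists_periodic_extension
    (f := fun θ ρ => radSpeed e θ ρ / angSpeed e θ ρ) hT
    (fun θ ρ => by simp only [radSpeed_add_two_pi, angSpeed_add_two_pi])
    (fun t ht => ((hα ρ hρ).2 t ht).1) ((hα ρ hρ).1.trans hfix.symm)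
  refine ⟨β, hβ1, fun θ => ?_, hβ3⟩
  obtain ⟨s, hs, h⟩ := hβ1.exists_mem_Ico₀ hT θ
  have hs' := Ico_subset_Icc_self hs
  rw [h, hβ2 s hs']
  exact hmem ρ hρ s hs'

/-- The closed curve given as a graph over the angle is run through at the angular speed of the
field, which is bounded away from zero. -/
theorem isPeriodicOrbit_of_periodic_polar_solution (he : Continuous e)
    (hB : ∀ θ, ∀ ρ ∈ Icc (ρ₀ - 2 * κ) (ρ₀ + 2 * κ), 1 / 2 < angSpeed e θ ρ ∧ angSpeed e θ ρ < 2)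
    {β : ℝ → ℝ} (hper : Periodic β (2 * π))
    (hmem : ∀ θ, β θ ∈ Ioo (ρ₀ - 2 * κ) (ρ₀ + 2 * κ))
    (hβ : ∀ θ, HasDerivAt β (radSpeed e θ (β θ) / angSpeed e θ (β θ)) θ) :
    IsPeriodicOrbit (oscField e) (range fun θ => polarPt θ (β θ)) := by
  have hB' := fun θ => hB θ (β θ) (Ioo_subset_Icc_self (hmem θ))
  have hβc : Continuous β := continuous_iff_continuousAt.2 fun t => (hβ t).continuousAt
  have hpc : Continuous fun θ => polarPt θ (β θ) :=
    continuous_polarPt.comp (continuous_id.prodMk hβc)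
  have hBc : Continuous fun θ => angSpeed e θ (β θ) := by unfold angSpeed; fun_prop
  obtain ⟨φ, T, hT, hsurj, hφ, hφT⟩ := exists_time_parametrization hBc (P := 2 * π)
    (by positivity) hB' (fun θ => by simp only [hper θ, angSpeed_add_two_pi])
  refine ⟨fun t => polarPt (φ t) (β (φ t)), T, hT, fun t => ?_, fun t => ?_, ?_, ?_⟩
  · have h1 : HasDerivAt (fun t => β (φ t)) (1 * radSpeed e (φ t) (β (φ t))) t := by
      refine ((hβ (φ t)).comp t (hφ t)).congr_deriv ?_
      have := (hB' (φ t)).1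
      rw [one_mul, div_mul_cancel₀ _ (by linarith)]
    have h2 := hasDerivAt_polarPt (c := 1) (by simpa using hφ t) h1
    simpa using h2
  · simp only [hφT, hper (φ t), polarPt_add_two_pi]
  · obtain ⟨t, ht⟩ := hsurj (φ 0 + π)
    refine ⟨t, fun h => ?_⟩
    obtain ⟨-, k, hk⟩ := eq_and_exists_of_polarPt_eq h
    rw [ht] at hk
    have h1 : (1 : ℝ) = k * 2 := by
      have := pi_pos.ne'
      field_simp at hk ⊢
      nlinarith [pi_pos]
    have : (1 : ℤ) = k * 2 := by exact_mod_cast h1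
    omega
  · exact (hsurj.range_comp fun θ => polarPt θ (β θ)).symm

/-- If the rate of `V` per unit of angle is strictly increasing in the radius, a periodic orbit in the
annulus is the only one: for any other one the difference of `V` at equal angles would be both
periodic and strictly monotone in time. -/
theorem isLimitCycle_of_periodic_polar_solution (he : Continuous e)
    (hV : ∀ p, ∃ V' : ℝ × ℝ →L[ℝ] ℝ, HasFDerivAt V V' p ∧ V' (oscField e p) = g p)
    (hB : ∀ θ, ∀ ρ ∈ Icc (ρ₀ - 2 * κ) (ρ₀ + 2 * κ), 1 / 2 < angSpeed e θ ρ ∧ angSpeed e θ ρ < 2)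
    (hL : ∀ θ, LipschitzOnWith 1 (fun ρ => radSpeed e θ ρ / angSpeed e θ ρ)
      (Icc (ρ₀ - 2 * κ) (ρ₀ + 2 * κ)))
    (hG : ∀ θ, StrictMonoOn (fun ρ => g (polarPt θ ρ) / angSpeed e θ ρ)
      (Icc (ρ₀ - 2 * κ) (ρ₀ + 2 * κ)))
    {β : ℝ → ℝ} (hper : Periodic β (2 * π))
    (hmem : ∀ θ, β θ ∈ Ioo (ρ₀ - 2 * κ) (ρ₀ + 2 * κ))
    (hβ : ∀ θ, HasDerivAt β (radSpeed e θ (β θ) / angSpeed e θ (β θ)) θ) :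
    IsLimitCycle (oscField e) (range fun θ => polarPt θ (β θ)) := by
  refine ⟨isPeriodicOrbit_of_periodic_polar_solution he hB hper hmem hβ,
    {p | exp (ρ₀ - 2 * κ) ^ 2 < p.1 ^ 2 + p.2 ^ 2 ∧ p.1 ^ 2 + p.2 ^ 2 < exp (ρ₀ + 2 * κ) ^ 2},
    ?_, ?_, ?_⟩
  · have h : Continuous fun p : ℝ × ℝ => p.1 ^ 2 + p.2 ^ 2 := by fun_prop
    exact (isOpen_lt continuous_const h).inter (isOpen_lt h continuous_const)
  · rintro _ ⟨θ, rfl⟩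
    simp only [mem_ofPred_eq, polarPt_sq]
    exact ⟨pow_lt_pow_left₀ (exp_lt_exp.2 (hmem θ).1) (exp_pos _).le two_ne_zero,
      pow_lt_pow_left₀ (exp_lt_exp.2 (hmem θ).2) (exp_pos _).le two_ne_zero⟩
  rintro _ ⟨γ, T, hT, hγ, hγT, -, rfl⟩ hsub
  have hin := fun t => hsub (mem_range_self t)
  obtain ⟨φ, r, hγr, hφ, hr⟩ := exists_polar_lift he hγ (fun t h0 => by
    have := (hin t).1
    rw [h0] at this
    have h2 := pow_pos (exp_pos (ρ₀ - 2 * κ)) 2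
    simp at this
    linarith)
  have hrmem : ∀ t, r t ∈ Ioo (ρ₀ - 2 * κ) (ρ₀ + 2 * κ) := fun t => by
    have := hin t
    simp only [mem_ofPred_eq, hγr t, polarPt_sq] at this
    exact ⟨exp_lt_exp.1 (lt_of_pow_lt_pow_left₀ 2 (exp_pos _).le this.1),
      exp_lt_exp.1 (lt_of_pow_lt_pow_left₀ 2 (exp_pos _).le this.2)⟩
  have hrmem' := fun t => Ioo_subset_Icc_self (hrmem t)
  have hmem' := fun t => Ioo_subset_Icc_self (hmem t)
  set b : ℝ → ℝ := fun t => angSpeed e (φ t) (r t) with hb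
  have hbb : ∀ t, 1 / 2 < b t ∧ b t < 2 := fun t => hB _ _ (hrmem' t)
  have hβφ : ∀ t, HasDerivAt (fun t => β (φ t))
      (b t * (radSpeed e (φ t) (β (φ t)) / angSpeed e (φ t) (β (φ t)))) t := fun t =>
    ((hβ (φ t)).comp t (hφ t)).congr_deriv (mul_comm _ _)
  -- Both radii solve the same scalar equation along the angle `φ`. The constant 2 is the bound on
  -- the angular speed times the Lipschitz constant 1.
  have huniq : ∀ t₀, r t₀ = β (φ t₀) → r = fun t => β (φ t) := fun t₀ h =>
    ODE_solution_unique_univ (K := 2)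
      (v := fun t ρ => b t * (radSpeed e (φ t) ρ / angSpeed e (φ t) ρ))
      (s := fun _ => Icc (ρ₀ - 2 * κ) (ρ₀ + 2 * κ))
      (fun t => by
        refine LipschitzOnWith.of_dist_le_mul fun x hx y hy => ?_
        have h1 := (hL (φ t)).dist_le_mul x hx y hy
        rw [Real.dist_eq] at h1 ⊢
        rw [← mul_sub, abs_mul, abs_of_pos (by linarith [(hbb t).1])]
        have h2 := mul_le_mul (hbb t).2.le h1 (abs_nonneg _) two_pos.le
        simpa using h2)
      (fun t => ⟨(hr t).congr_deriv (mul_div_cancel₀ _ (by linarith [(hbb t).1])).symm, hrmem' t⟩)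
      (fun t => ⟨hβφ t, hmem' _⟩) h
  by_cases hex : ∃ t₀, r t₀ = β (φ t₀)
  · obtain ⟨t₀, h⟩ := hex
    have heq := huniq t₀ h
    have hγeq : γ = (fun θ => polarPt θ (β θ)) ∘ φ := funext fun t => by
      rw [hγr t, heq]; rfl
    rw [hγeq, (surjective_of_half_le_deriv hφ fun t => (hbb t).1.le).range_comp]
  exfalso
  push Not at hex
  set D : ℝ → ℝ := fun t => V (polarPt (φ t) (r t)) - V (polarPt (φ t) (β (φ t))) with hD
  set G : ℝ → ℝ → ℝ := fun θ ρ => g (polarPt θ ρ) / angSpeed e θ ρ with hGdef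
  have hDd : ∀ t, HasDerivAt D (b t * (G (φ t) (r t) - G (φ t) (β (φ t)))) t := fun t => by
    have h1 := hasDerivAt_along_angle hV (φ := φ) (ρ := r) (t := t) (c := 1)
      (by simpa using hφ t) (by simpa using hr t)
    have hne := (hB (φ t) (β (φ t)) (hmem' _)).1
    have hne' : angSpeed e (φ t) (β (φ t)) ≠ 0 := by linarith
    -- The curve `β ∘ φ` is traversed at the angular speed `b` of the other orbit rather than its
    -- own, hence the quotient.
    have h2 := hasDerivAt_along_angle hV (φ := φ) (ρ := fun t => β (φ t)) (t := t)
      (c := b t / angSpeed e (φ t) (β (φ t)))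
      (by rw [div_mul_cancel₀ _ hne']; exact hφ t)
      ((hβφ t).congr_deriv (by ring))
    refine (h1.sub h2).congr_deriv ?_
    have : b t ≠ 0 := by linarith [(hbb t).1]
    simp only [hGdef]
    rw [mul_sub, show angSpeed e (φ t) (r t) = b t from rfl, mul_div_cancel₀ _ this]
    ring
  have hDT : D T = D 0 := by
    have h1 : polarPt (φ T) (r T) = polarPt (φ 0) (r 0) := by
      rw [← hγr, ← hγr]; simpa using hγT 0
    obtain ⟨-, k, hk⟩ := eq_and_exists_of_polarPt_eq h1
    have h2 : β (φ T) = β (φ 0) := by rw [hk]; exact hper.int_mul k (φ 0)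
    have h3 : polarPt (φ T) (β (φ 0)) = polarPt (φ 0) (β (φ 0)) := by
      rw [hk]
      simp [polarPt]
    simp only [hD]
    rw [h1, h2, h3]
  have hwc : Continuous fun t => r t - β (φ t) := continuous_iff_continuousAt.2 fun t =>
    ((hr t).sub (hβφ t)).continuousAt
  have hsign : (∀ t, β (φ t) < r t) ∨ ∀ t, r t < β (φ t) := by
    by_contra! hcon
    obtain ⟨⟨s, hs⟩, ⟨t, ht⟩⟩ := hcon
    obtain ⟨z, hz⟩ := mem_range_of_exists_le_of_exists_ge hwc (c := 0)
      ⟨s, by linarith⟩ ⟨t, by linarith⟩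
    exact hex z (by linarith)
  rcases hsign with h | h
  · have : StrictMono D := strictMono_of_deriv_pos fun t => by
      rw [(hDd t).deriv]
      exact mul_pos (by linarith [(hbb t).1])
        (sub_pos.2 (hG _ (hmem' _) (hrmem' _) (h t)))
    exact absurd hDT (this hT).ne'
  · have : StrictAnti D := strictAnti_of_deriv_neg fun t => by
      rw [(hDd t).deriv]
      exact mul_neg_of_pos_of_neg (by linarith [(hbb t).1])
        (sub_neg.2 (hG _ (hrmem' _) (hmem' _) (h t)))
    exact absurd hDT (this hT).ne

end

/-! ### From a simple zero of the averaged rate to a limit cycle. -/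

theorem eventually_forall_mem_of_continuousAt {h : ℝ × ℝ × ℝ → ℝ} {S : Set ℝ} (hS : IsOpen S)
    {J I : Set ℝ} (hJ : IsCompact J) (hI : IsCompact I)
    (hc : ∀ θ ∈ J, ∀ ρ ∈ I, ContinuousAt h (0, θ, ρ)) (hmem : ∀ θ ∈ J, ∀ ρ ∈ I, h (0, θ, ρ) ∈ S) :
    ∀ᶠ η in 𝓝 (0 : ℝ), ∀ θ ∈ J, ∀ ρ ∈ I, h (η, θ, ρ) ∈ S := by
  have := (hJ.prod hI).eventually_forall_of_forall_eventually (x₀ := (0 : ℝ))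
    (P := fun η q => h (η, q) ∈ S)
    (fun q hq => (hc q.1 hq.1 q.2 hq.2).eventually_mem (hS.mem_nhds (hmem q.1 hq.1 q.2 hq.2)))
  exact this.mono fun η hη θ hθ ρ hρ => hη (θ, ρ) ⟨hθ, hρ⟩

/-- The radial derivative is jointly continuous for a C¹ function, so an open condition at `η = 0`
persists near each point, and compactness makes it uniform. -/
theorem eventually_forall_deriv_mem {h : ℝ × ℝ × ℝ → ℝ} {S : Set ℝ} (hS : IsOpen S)
    {J I : Set ℝ} (hJ : IsCompact J) (hI : IsCompact I)
    (hc : ∀ θ ∈ J, ∀ ρ ∈ I, ContDiffAt ℝ 1 h (0, θ, ρ)) {d : ℝ → ℝ → ℝ}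
    (hd : ∀ θ ∈ J, ∀ ρ ∈ I, HasDerivAt (fun r => h (0, θ, r)) (d θ ρ) ρ)
    (hmem : ∀ θ ∈ J, ∀ ρ ∈ I, d θ ρ ∈ S) :
    ∀ᶠ η in 𝓝 (0 : ℝ), ∀ θ ∈ J, ∀ ρ ∈ I, ∃ d' ∈ S, HasDerivAt (fun r => h (η, θ, r)) d' ρ := by
  have hline : ∀ η θ ρ : ℝ, HasDerivAt (fun r : ℝ => (η, θ, r)) ((0 : ℝ), (0 : ℝ), (1 : ℝ)) ρ :=
    fun η θ ρ => (hasDerivAt_const ρ η).prodMk ((hasDerivAt_const ρ θ).prodMk (hasDerivAt_id ρ))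
  have := (hJ.prod hI).eventually_forall_of_forall_eventually (x₀ := (0 : ℝ))
    (P := fun η q => ∃ d' ∈ S, HasDerivAt (fun r => h (η, q.1, r)) d' q.2)
    (fun q hq => by
      have hcd := hc q.1 hq.1 q.2 hq.2
      have hdiff : ∀ᶠ z in 𝓝 ((0 : ℝ), q), DifferentiableAt ℝ h z := by
        filter_upwards [hcd.eventually (by simp)] with z hz
        exact hz.differentiableAt (by simp)
      have hfc : ContinuousAt (fun z => fderiv ℝ h z (0, 0, 1)) ((0 : ℝ), q) :=
        ((hcd.fderiv_right (m := 0) (by simp)).continuousAt).clm_apply continuousAt_const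
      have h0 : fderiv ℝ h ((0 : ℝ), q) (0, 0, 1) = d q.1 q.2 :=
        (((hcd.differentiableAt (by simp)).hasFDerivAt.comp_hasDerivAt q.2
          (hline 0 q.1 q.2)).unique (hd q.1 hq.1 q.2 hq.2))
      filter_upwards [hdiff, hfc.eventually_mem (hS.mem_nhds
        (by rw [h0]; exact hmem q.1 hq.1 q.2 hq.2))] with z hz1 hz2
      exact ⟨_, hz2, hz1.hasFDerivAt.comp_hasDerivAt z.2.2 (hline z.1 z.2.1 z.2.2)⟩)
  exact this.mono fun η hη θ hθ ρ hρ => hη (θ, ρ) ⟨hθ, hρ⟩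

theorem strictMonoOn_Icc_of_hasDerivAt_pos {h : ℝ → ℝ} {a b : ℝ}
    (hd : ∀ x ∈ Icc a b, ∃ d ∈ Ioi (0 : ℝ), HasDerivAt h d x) : StrictMonoOn h (Icc a b) := by
  refine strictMonoOn_of_deriv_pos (convex_Icc a b) (fun x hx => ?_) fun x hx => ?_
  · obtain ⟨d, -, h⟩ := hd x hx
    exact h.continuousAt.continuousWithinAt
  · obtain ⟨d, hpos, h⟩ := hd x (interior_subset hx)
    rw [h.deriv]
    exact hpos

theorem lipschitzOnWith_one_of_hasDerivAt {h : ℝ → ℝ} {a b : ℝ}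
    (hd : ∀ x ∈ Icc a b, ∃ d ∈ Ioo (-1 : ℝ) 1, HasDerivAt h d x) :
    LipschitzOnWith 1 h (Icc a b) := by
  choose! d hmem h' using hd
  refine (convex_Icc a b).lipschitzOnWith_of_nnnorm_hasDerivWithin_le
    (fun x hx => (h' x hx).hasDerivWithinAt) fun x hx => ?_
  rw [← NNReal.coe_le_coe, coe_nnnorm, Real.norm_eq_abs]
  exact (abs_lt.2 (hmem x hx)).le

/-- Reduces estimates over all angles to a compact interval, where the uniformity in `η` is
available. -/
theorem exists_mem_Icc_polar_eq (e : ℝ × ℝ → ℝ) (θ : ℝ) :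
    ∃ θ' ∈ Icc 0 (2 * π), polarPt θ = polarPt θ' ∧ radSpeed e θ = radSpeed e θ' ∧
      angSpeed e θ = angSpeed e θ' := by
  have hper : Periodic (fun θ => (cos θ, sin θ)) (2 * π) := fun θ => by simp
  obtain ⟨θ', hθ', h⟩ := hper.exists_mem_Ico₀ (by positivity) θ
  simp only [Prod.mk.injEq] at h
  have hp : polarPt θ = polarPt θ' := funext fun ρ => by simp only [polarPt, h.1, h.2]
  refine ⟨θ', Ico_subset_Icc_self hθ', hp, funext fun ρ => ?_, funext fun ρ => ?_⟩
  · simp only [radSpeed, h.2, hp]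
  · simp only [angSpeed, h.1, hp]

/-- A simple zero of the averaged rate `F` yields a limit cycle near the corresponding circle for all
small `η > 0`. -/
theorem eventually_exists_isLimitCycle {E R V : ℝ → ℝ × ℝ → ℝ} {F a : ℝ → ℝ}
    (hE : ContDiff ℝ 1 fun q : ℝ × ℝ × ℝ => E q.1 q.2)
    (hR : ContDiff ℝ 1 fun q : ℝ × ℝ × ℝ => R q.1 q.2)
    (hVs : ContDiff ℝ 1 fun q : ℝ × ℝ × ℝ => V q.1 q.2) (hF : ContDiff ℝ 1 F)
    (hV0 : ∀ p, V 0 p = (p.1 ^ 2 + p.2 ^ 2) / 2) (ha : ∀ η, 0 < η → a η ≠ 0)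
    (hV : ∀ η p, ∃ V' : ℝ × ℝ →L[ℝ] ℝ, HasFDerivAt (V η) V' p ∧
      V' (oscField (fun p => η * E η p) p) = a η * (F (p.1 ^ 2 + p.2 ^ 2) + η * R η p))
    {ρ₀ δ : ℝ} (hδ : 0 < δ) (hF0 : F (exp ρ₀ ^ 2) = 0) (hF' : 0 < deriv F (exp ρ₀ ^ 2)) :
    ∀ᶠ η in 𝓝[>] (0 : ℝ), ∃ Γ, IsLimitCycle (oscField fun p => η * E η p) Γ ∧
      ∀ p ∈ Γ, ∃ θ, ∃ ρ ∈ Ioo (ρ₀ - δ) (ρ₀ + δ), p = polarPt θ ρ := by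
  set ψ : ℝ → ℝ := fun ρ => F (exp ρ ^ 2) with hψ
  have hψd : ∀ ρ, HasDerivAt ψ (deriv F (exp ρ ^ 2) * (2 * exp ρ ^ 2)) ρ := fun ρ => by
    refine (((hF.differentiable (by simp)) (exp ρ ^ 2)).hasDerivAt.comp ρ
      ((Real.hasDerivAt_exp ρ).pow 2)).congr_deriv ?_
    push_cast
    ring
  have hψc : Continuous fun ρ => deriv F (exp ρ ^ 2) * (2 * exp ρ ^ 2) :=
    ((hF.continuous_deriv (by simp)).comp (by fun_prop)).mul (by fun_prop)
  obtain ⟨κ, hκ, hκδ, hκd⟩ : ∃ κ, 0 < κ ∧ 2 * κ ≤ δ ∧ ∀ ρ ∈ Icc (ρ₀ - 2 * κ) (ρ₀ + 2 * κ),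
      0 < deriv F (exp ρ ^ 2) * (2 * exp ρ ^ 2) := by
    have h1 : ∀ᶠ ρ in 𝓝 ρ₀, 0 < deriv F (exp ρ ^ 2) * (2 * exp ρ ^ 2) :=
      hψc.continuousAt.eventually_mem (Ioi_mem_nhds (by positivity))
    obtain ⟨r, hr, h2⟩ := Metric.eventually_nhds_iff_ball.1 h1
    refine ⟨min (r / 4) (δ / 2), by positivity, by linarith [min_le_right (r / 4) (δ / 2)],
      fun ρ hρ => h2 ρ ?_⟩
    rw [Real.ball_eq_Ioo]
    have := min_le_left (r / 4) (δ / 2)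
    exact ⟨by linarith [hρ.1], by linarith [hρ.2]⟩
  set I := Icc (ρ₀ - 2 * κ) (ρ₀ + 2 * κ) with hI
  have hψmono : StrictMonoOn ψ I := strictMonoOn_Icc_of_hasDerivAt_pos
    fun ρ hρ => ⟨_, hκd ρ hρ, hψd ρ⟩
  have hρ₀ : ρ₀ ∈ I := ⟨by linarith, by linarith⟩
  have hJ : IsCompact (Icc (0 : ℝ) (2 * π)) := isCompact_Icc
  have hIc : IsCompact I := isCompact_Icc
  have hpt : ContDiff ℝ 1 fun q : ℝ × ℝ × ℝ => (q.1, polarPt q.2.1 q.2.2) := by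
    unfold polarPt; fun_prop
  have hEp : ContDiff ℝ 1 fun q : ℝ × ℝ × ℝ => E q.1 (polarPt q.2.1 q.2.2) := hE.comp hpt
  have hRp : ContDiff ℝ 1 fun q : ℝ × ℝ × ℝ => R q.1 (polarPt q.2.1 q.2.2) := hR.comp hpt
  have hVp : ContDiff ℝ 1 fun q : ℝ × ℝ × ℝ => V q.1 (polarPt q.2.1 q.2.2) := hVs.comp hpt
  set e : ℝ → ℝ × ℝ → ℝ := fun η p => η * E η p with he
  set B : ℝ × ℝ × ℝ → ℝ := fun q => angSpeed (e q.1) q.2.1 q.2.2 with hB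
  set A : ℝ × ℝ × ℝ → ℝ := fun q => radSpeed (e q.1) q.2.1 q.2.2 with hA
  set g : ℝ → ℝ × ℝ → ℝ := fun η p => F (p.1 ^ 2 + p.2 ^ 2) + η * R η p with hg
  set N : ℝ × ℝ × ℝ → ℝ := fun q => g q.1 (polarPt q.2.1 q.2.2) with hN
  have hBs : ContDiff ℝ 1 B := by simp only [hB, angSpeed, he]; fun_prop
  have hAs : ContDiff ℝ 1 A := by simp only [hA, radSpeed, he]; fun_prop
  have hNs : ContDiff ℝ 1 N := by
    simp only [hN, hg, polarPt_sq]
    exact (hF.comp (by fun_prop)).add (by fun_prop)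
  have hB0 : ∀ θ ρ, B (0, θ, ρ) = 1 := fun θ ρ => by simp [hB, angSpeed, he]
  have hA0 : ∀ θ ρ, A (0, θ, ρ) = 0 := fun θ ρ => by simp [hA, radSpeed, he]
  have hN0 : ∀ θ ρ, N (0, θ, ρ) = ψ ρ := fun θ ρ => by simp [hN, hg, polarPt_sq, hψ]
  have hfs : ∀ θ ρ, ContDiffAt ℝ 1 (fun q => A q / B q) (0, θ, ρ) := fun θ ρ =>
    hAs.contDiffAt.div hBs.contDiffAt (by rw [hB0]; exact one_ne_zero)
  have hGs : ∀ θ ρ, ContDiffAt ℝ 1 (fun q => N q / B q) (0, θ, ρ) := fun θ ρ =>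
    hNs.contDiffAt.div hBs.contDiffAt (by rw [hB0]; exact one_ne_zero)
  -- All hypotheses of the annulus theorems are open conditions on compact sets that hold at `η =
  -- 0`, where the angular speed is 1, the radial speed 0, the rate `ψ ρ` and the energy half the
  -- squared radius.
  have ev1 := eventually_forall_mem_of_continuousAt (S := Ioo (1 / 2) 2) isOpen_Ioo hJ hIc
    (fun θ _ ρ _ => hBs.continuous.continuousAt) (fun θ _ ρ _ => by rw [hB0]; norm_num)
  have ev2 := eventually_forall_mem_of_continuousAt (S := Ioo (-(κ / 16)) (κ / 16)) isOpen_Ioo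
    hJ hIc (fun θ _ ρ _ => (hfs θ ρ).continuousAt)
    (fun θ _ ρ _ => by rw [hA0, zero_div]; exact ⟨by linarith, by linarith⟩)
  have ev3 := eventually_forall_deriv_mem (S := Ioo (-1 : ℝ) 1) isOpen_Ioo hJ hIc
    (fun θ _ ρ _ => hfs θ ρ) (d := fun _ _ => 0)
    (fun θ _ ρ _ => by simpa only [hA0, zero_div] using hasDerivAt_const ρ (0 : ℝ))
    (fun θ _ ρ _ => by norm_num)
  have ev4 := eventually_forall_deriv_mem (S := Ioi (0 : ℝ)) isOpen_Ioi hJ hIc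
    (fun θ _ ρ _ => hGs θ ρ) (d := fun _ ρ => deriv F (exp ρ ^ 2) * (2 * exp ρ ^ 2))
    (fun θ _ ρ _ => by simpa only [hN0, hB0, div_one] using hψd ρ)
    (fun θ _ ρ hρ => hκd ρ hρ)
  have ev5 := eventually_forall_mem_of_continuousAt (S := Ioi (0 : ℝ)) isOpen_Ioi hJ
    (isCompact_Icc (a := ρ₀ + κ / 2) (b := ρ₀ + 2 * κ))
    (fun θ _ ρ _ => hNs.continuous.continuousAt) (fun θ _ ρ hρ => by
      rw [hN0, mem_Ioi, ← hF0]
      exact hψmono hρ₀ ⟨by linarith [hρ.1], hρ.2⟩ (by linarith [hρ.1]))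
  have ev6 := eventually_forall_mem_of_continuousAt (S := Iio (0 : ℝ)) isOpen_Iio hJ
    (isCompact_Icc (a := ρ₀ - 2 * κ) (b := ρ₀ - κ / 2))
    (fun θ _ ρ _ => hNs.continuous.continuousAt) (fun θ _ ρ hρ => by
      rw [hN0, mem_Iio, ← hF0]
      exact hψmono ⟨hρ.1, by linarith [hρ.2]⟩ hρ₀ (by linarith [hρ.2]))
  have ev7 := eventually_forall_deriv_mem (S := Ioi (0 : ℝ)) isOpen_Ioi hJ hIc
    (fun θ _ ρ _ => hVp.contDiffAt) (d := fun _ ρ => exp ρ ^ 2)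
    (fun θ _ ρ _ => by
      simp only [hV0, polarPt_sq]
      refine (((Real.hasDerivAt_exp ρ).pow 2).div_const 2).congr_deriv ?_
      push_cast
      ring)
    (fun θ _ ρ hρ => by rw [mem_Ioi]; positivity)
  filter_upwards [nhdsWithin_le_nhds ev1, nhdsWithin_le_nhds ev2, nhdsWithin_le_nhds ev3,
    nhdsWithin_le_nhds ev4, nhdsWithin_le_nhds ev5, nhdsWithin_le_nhds ev6,
    nhdsWithin_le_nhds ev7, self_mem_nhdsWithin] with η h1 h2 h3 h4 h5 h6 h7 hη
  have haη := ha η hη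
  have hec : Continuous (e η) :=
    continuous_const.mul (hE.continuous.comp (continuous_const.prodMk continuous_id))
  -- Dividing by `a η` normalizes the rate. As `a η` may be negative, the new function may decrease
  -- with the radius, so only its injectivity is used.
  have hV' : ∀ p, ∃ V' : ℝ × ℝ →L[ℝ] ℝ,
      HasFDerivAt (fun p => (a η)⁻¹ * V η p) V' p ∧ V' (oscField (e η) p) = g η p := fun p => by
    obtain ⟨V', hd, hval⟩ := hV η p
    refine ⟨(a η)⁻¹ • V', hd.const_mul _, ?_⟩
    rw [smul_apply, hval, smul_eq_mul, inv_mul_cancel_left₀ haη]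
  have hBη : ∀ θ, ∀ ρ ∈ I, 1 / 2 < angSpeed (e η) θ ρ ∧ angSpeed (e η) θ ρ < 2 :=
    fun θ ρ hρ => by
      obtain ⟨θ', hθ', -, -, q3⟩ := exists_mem_Icc_polar_eq (e η) θ
      rw [q3]
      exact h1 θ' hθ' ρ hρ
  have hLη : ∀ θ, LipschitzOnWith 1 (fun ρ => radSpeed (e η) θ ρ / angSpeed (e η) θ ρ) I :=
    fun θ => by
      obtain ⟨θ', hθ', -, q2, q3⟩ := exists_mem_Icc_polar_eq (e η) θ
      rw [q2, q3]
      exact lipschitzOnWith_one_of_hasDerivAt (h3 θ' hθ')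
  obtain ⟨β, hβ1, hβ2, hβ3⟩ := exists_periodic_polar_solution hec hV' hκ hBη
    (fun θ ρ hρ => by
      obtain ⟨θ', hθ', -, q2, q3⟩ := exists_mem_Icc_polar_eq (e η) θ
      rw [q2, q3]
      exact (abs_lt.2 (h2 θ' hθ' ρ hρ)).le) hLη
    (fun θ ρ hρ => by
      obtain ⟨θ', hθ', q1, -, -⟩ := exists_mem_Icc_polar_eq (e η) θ
      rw [q1]
      exact h5 θ' hθ' ρ hρ)
    (fun θ ρ hρ => by
      obtain ⟨θ', hθ', q1, -, -⟩ := exists_mem_Icc_polar_eq (e η) θ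
      rw [q1]
      exact h6 θ' hθ' ρ hρ)
    (fun x hx y hy hxy => by
      refine (strictMonoOn_Icc_of_hasDerivAt_pos (h7 0 ⟨le_rfl, by positivity⟩)).injOn hx hy ?_
      exact mul_left_cancel₀ (inv_ne_zero haη) hxy)
  refine ⟨_, isLimitCycle_of_periodic_polar_solution hec hV' hBη hLη (fun θ => ?_) hβ1 hβ2 hβ3, ?_⟩
  · obtain ⟨θ', hθ', q1, -, q3⟩ := exists_mem_Icc_polar_eq (e η) θ
    rw [q1, q3]
    exact strictMonoOn_Icc_of_hasDerivAt_pos (h4 θ' hθ')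
  · rintro _ ⟨θ, rfl⟩
    exact ⟨θ, β θ, ⟨by linarith [(hβ2 θ).1], by linarith [(hβ2 θ).2]⟩, rfl⟩

/-! ### Polynomial corrections of the energy and the averaged rate. -/

/-- `f` has the partial derivatives `a` and `b` at `p`, in the sense of Fréchet. -/
def HasGrad (f : ℝ × ℝ → ℝ) (a b : ℝ) (p : ℝ × ℝ) : Prop :=
  HasFDerivAt f (a • ContinuousLinearMap.fst ℝ ℝ ℝ + b • ContinuousLinearMap.snd ℝ ℝ ℝ) p

theorem HasGrad.congr {f : ℝ × ℝ → ℝ} {a b a' b' : ℝ} {p : ℝ × ℝ} (h : HasGrad f a b p)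
    (ha : a = a') (hb : b = b') : HasGrad f a' b' p := ha ▸ hb ▸ h

theorem HasGrad.add {f g : ℝ × ℝ → ℝ} {a b a' b' : ℝ} {p : ℝ × ℝ} (hf : HasGrad f a b p)
    (hg : HasGrad g a' b' p) : HasGrad (fun q => f q + g q) (a + a') (b + b') p := by
  refine (HasFDerivAt.add hf hg).congr_fderiv ?_
  ext <;> simp

theorem HasGrad.const_mul {f : ℝ × ℝ → ℝ} {a b : ℝ} {p : ℝ × ℝ} (c : ℝ) (hf : HasGrad f a b p) :
    HasGrad (fun q => c * f q) (c * a) (c * b) p := by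
  refine (HasFDerivAt.const_mul hf c).congr_fderiv ?_
  ext <;> simp

theorem hasGrad_monomial (c : ℝ) (i j : ℕ) (p : ℝ × ℝ) :
    HasGrad (fun q => c * q.1 ^ i * q.2 ^ j) (c * (i * p.1 ^ (i - 1)) * p.2 ^ j)
      (c * p.1 ^ i * (j * p.2 ^ (j - 1))) p := by
  have h := ((hasFDerivAt_fst (𝕜 := ℝ) (p := p)).pow i |>.const_mul c).mul
    ((hasFDerivAt_snd (𝕜 := ℝ) (p := p)).pow j)
  refine h.congr_fderiv ?_
  ext <;> simp
  ring

/-- The damping `y² - 3x² + 3ηx⁴`, which is exact to first order: times `y²` it is the derivative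
of `x y³` along the Hamiltonian field. -/
def exactDamping (η x y : ℝ) : ℝ := y ^ 2 - 3 * x ^ 2 + 3 * η * x ^ 4

/-- The higher order damping that unfolds the five limit cycles. -/
noncomputable def unfoldingDamping (η x y : ℝ) : ℝ :=
  (135 / 32 * η ^ 3) + (-1233 / 32 * η ^ 3) * x ^ 2 + (24 / 7 - 225 / 14 * η) * x ^ 4
    + (-30 / 7 * η + 180 / 7 * η ^ 2 - 153 / 4 * η ^ 3) * x ^ 6
    + (-24 / 35 + 45 / 14 * η + 405 / 32 * η ^ 3) * y ^ 4

/-- The second order correction of the energy. -/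
noncomputable def secondCorrection (η x y : ℝ) : ℝ :=
  (3 / 2) * x ^ 2 * y ^ 4 + (-3 / 4) * x ^ 4 * y ^ 2 + (-1 / 4) * x ^ 6 * y ^ 0
    + (1 / 2 * η) * x ^ 6 * y ^ 2 + (5 / 16 * η) * x ^ 8 * y ^ 0
    + (-1 / 10 * η ^ 2) * x ^ 10 * y ^ 0

/-- The partial derivative of `secondCorrection` in `x`. -/
noncomputable def secondCorrectionX (η x y : ℝ) : ℝ :=
  (3 / 2) * (2 * x ^ 1) * y ^ 4 + (-3 / 4) * (4 * x ^ 3) * y ^ 2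
    + (-1 / 4) * (6 * x ^ 5) * y ^ 0 + (1 / 2 * η) * (6 * x ^ 5) * y ^ 2
    + (5 / 16 * η) * (8 * x ^ 7) * y ^ 0 + (-1 / 10 * η ^ 2) * (10 * x ^ 9) * y ^ 0

/-- The partial derivative of `secondCorrection` in `y`. -/
noncomputable def secondCorrectionY (η x y : ℝ) : ℝ :=
  (3 / 2) * x ^ 2 * (4 * y ^ 3) + (-3 / 4) * x ^ 4 * (2 * y ^ 1)
    + (1 / 2 * η) * x ^ 6 * (2 * y ^ 1)

/-- The third order correction of the energy. -/
noncomputable def thirdCorrection (η x y : ℝ) : ℝ :=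
  (-135 / 64 * η ^ 3) * x ^ 1 * y ^ 1 + (-1233 / 256 * η ^ 3) * x ^ 1 * y ^ 3
    + (24 / 35 - 45 / 14 * η - 4455 / 512 * η ^ 3) * x ^ 1 * y ^ 5
    + (-765 / 512 * η ^ 3) * x ^ 1 * y ^ 7 + (135 / 512 * η ^ 3) * x ^ 1 * y ^ 9
    + (-9 / 512 * η ^ 3) * x ^ 1 * y ^ 11 + (1233 / 256 * η ^ 3) * x ^ 3 * y ^ 1
    + (8 / 7 - 75 / 14 * η - 675 / 64 * η ^ 3) * x ^ 3 * y ^ 3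
    + (-2 * η - 2805 / 512 * η ^ 3) * x ^ 3 * y ^ 5 + (315 / 256 * η ^ 3) * x ^ 3 * y ^ 7
    + (-51 / 512 * η ^ 3) * x ^ 3 * y ^ 9 + (-2025 / 512 * η ^ 3) * x ^ 5 * y ^ 1
    + (17 / 14 * η + 45 / 14 * η ^ 2 - 3723 / 512 * η ^ 3) * x ^ 5 * y ^ 3
    + (9 / 4 * η ^ 3) * x ^ 5 * y ^ 5 + (-297 / 1280 * η ^ 3) * x ^ 5 * y ^ 7
    + (765 / 512 * η ^ 3) * x ^ 7 * y ^ 1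
    + (-9 / 7 * η ^ 2 + 3555 / 1792 * η ^ 3) * x ^ 7 * y ^ 3
    + (-2529 / 8960 * η ^ 3) * x ^ 7 * y ^ 5 + (-135 / 512 * η ^ 3) * x ^ 9 * y ^ 1
    + (-667 / 3584 * η ^ 3) * x ^ 9 * y ^ 3 + (9 / 512 * η ^ 3) * x ^ 11 * y ^ 1

/-- The partial derivative of `thirdCorrection` in `x`. -/
noncomputable def thirdCorrectionX (η x y : ℝ) : ℝ :=
  (-135 / 64 * η ^ 3) * (1 * x ^ 0) * y ^ 1 + (-1233 / 256 * η ^ 3) * (1 * x ^ 0) * y ^ 3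
    + (24 / 35 - 45 / 14 * η - 4455 / 512 * η ^ 3) * (1 * x ^ 0) * y ^ 5
    + (-765 / 512 * η ^ 3) * (1 * x ^ 0) * y ^ 7 + (135 / 512 * η ^ 3) * (1 * x ^ 0) * y ^ 9
    + (-9 / 512 * η ^ 3) * (1 * x ^ 0) * y ^ 11 + (1233 / 256 * η ^ 3) * (3 * x ^ 2) * y ^ 1
    + (8 / 7 - 75 / 14 * η - 675 / 64 * η ^ 3) * (3 * x ^ 2) * y ^ 3
    + (-2 * η - 2805 / 512 * η ^ 3) * (3 * x ^ 2) * y ^ 5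
    + (315 / 256 * η ^ 3) * (3 * x ^ 2) * y ^ 7 + (-51 / 512 * η ^ 3) * (3 * x ^ 2) * y ^ 9
    + (-2025 / 512 * η ^ 3) * (5 * x ^ 4) * y ^ 1
    + (17 / 14 * η + 45 / 14 * η ^ 2 - 3723 / 512 * η ^ 3) * (5 * x ^ 4) * y ^ 3
    + (9 / 4 * η ^ 3) * (5 * x ^ 4) * y ^ 5 + (-297 / 1280 * η ^ 3) * (5 * x ^ 4) * y ^ 7
    + (765 / 512 * η ^ 3) * (7 * x ^ 6) * y ^ 1
    + (-9 / 7 * η ^ 2 + 3555 / 1792 * η ^ 3) * (7 * x ^ 6) * y ^ 3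
    + (-2529 / 8960 * η ^ 3) * (7 * x ^ 6) * y ^ 5 + (-135 / 512 * η ^ 3) * (9 * x ^ 8) * y ^ 1
    + (-667 / 3584 * η ^ 3) * (9 * x ^ 8) * y ^ 3 + (9 / 512 * η ^ 3) * (11 * x ^ 10) * y ^ 1

/-- The partial derivative of `thirdCorrection` in `y`. -/
noncomputable def thirdCorrectionY (η x y : ℝ) : ℝ :=
  (-135 / 64 * η ^ 3) * x ^ 1 * (1 * y ^ 0) + (-1233 / 256 * η ^ 3) * x ^ 1 * (3 * y ^ 2)
    + (24 / 35 - 45 / 14 * η - 4455 / 512 * η ^ 3) * x ^ 1 * (5 * y ^ 4)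
    + (-765 / 512 * η ^ 3) * x ^ 1 * (7 * y ^ 6) + (135 / 512 * η ^ 3) * x ^ 1 * (9 * y ^ 8)
    + (-9 / 512 * η ^ 3) * x ^ 1 * (11 * y ^ 10) + (1233 / 256 * η ^ 3) * x ^ 3 * (1 * y ^ 0)
    + (8 / 7 - 75 / 14 * η - 675 / 64 * η ^ 3) * x ^ 3 * (3 * y ^ 2)
    + (-2 * η - 2805 / 512 * η ^ 3) * x ^ 3 * (5 * y ^ 4)
    + (315 / 256 * η ^ 3) * x ^ 3 * (7 * y ^ 6) + (-51 / 512 * η ^ 3) * x ^ 3 * (9 * y ^ 8)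
    + (-2025 / 512 * η ^ 3) * x ^ 5 * (1 * y ^ 0)
    + (17 / 14 * η + 45 / 14 * η ^ 2 - 3723 / 512 * η ^ 3) * x ^ 5 * (3 * y ^ 2)
    + (9 / 4 * η ^ 3) * x ^ 5 * (5 * y ^ 4) + (-297 / 1280 * η ^ 3) * x ^ 5 * (7 * y ^ 6)
    + (765 / 512 * η ^ 3) * x ^ 7 * (1 * y ^ 0)
    + (-9 / 7 * η ^ 2 + 3555 / 1792 * η ^ 3) * x ^ 7 * (3 * y ^ 2)
    + (-2529 / 8960 * η ^ 3) * x ^ 7 * (5 * y ^ 4) + (-135 / 512 * η ^ 3) * x ^ 9 * (1 * y ^ 0)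
    + (-667 / 3584 * η ^ 3) * x ^ 9 * (3 * y ^ 2) + (9 / 512 * η ^ 3) * x ^ 11 * (1 * y ^ 0)

/-- The averaged derivative of the corrected energy, as a function of `u = x² + y²`; it equals
`-(9/512) u (u - 1) (u - 2) (u - 3) (u - 4) (u - 5)`. -/
noncomputable def averagedRate (u : ℝ) : ℝ :=
  -(9 / 512) * (u ^ 6 - 15 * u ^ 5 + 85 * u ^ 4 - 225 * u ^ 3 + 274 * u ^ 2 - 120 * u)

/-- The terms of order `η⁴` left over by `thirdCorrection`. -/
noncomputable def averagingRemainder (x y : ℝ) : ℝ :=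
  (-135 / 64) * x ^ 4 * y ^ 0 + (-3699 / 256) * x ^ 4 * y ^ 2 + (-22275 / 512) * x ^ 4 * y ^ 4
    + (-5355 / 512) * x ^ 4 * y ^ 6 + (1215 / 512) * x ^ 4 * y ^ 8
    + (-99 / 512) * x ^ 4 * y ^ 10 + (1233 / 256) * x ^ 6 * y ^ 0
    + (-2025 / 64) * x ^ 6 * y ^ 2 + (-14025 / 512) * x ^ 6 * y ^ 4
    + (2205 / 256) * x ^ 6 * y ^ 6 + (-459 / 512) * x ^ 6 * y ^ 8
    + (-2025 / 512) * x ^ 8 * y ^ 0 + (-11169 / 512) * x ^ 8 * y ^ 2 + (45 / 4) * x ^ 8 * y ^ 4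
    + (-2079 / 1280) * x ^ 8 * y ^ 6 + (765 / 512) * x ^ 10 * y ^ 0
    + (10665 / 1792) * x ^ 10 * y ^ 2 + (-2529 / 1792) * x ^ 10 * y ^ 4
    + (-135 / 512) * x ^ 12 * y ^ 0 + (-2001 / 3584) * x ^ 12 * y ^ 2
    + (9 / 512) * x ^ 14 * y ^ 0

theorem hasGrad_secondCorrection (η : ℝ) (p : ℝ × ℝ) :
    HasGrad (fun q => secondCorrection η q.1 q.2) (secondCorrectionX η p.1 p.2)
      (secondCorrectionY η p.1 p.2) p := by
  refine HasGrad.congr ((hasGrad_monomial (3 / 2) 2 4 p) |>.add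
      (hasGrad_monomial (-3 / 4) 4 2 p) |>.add
      (hasGrad_monomial (-1 / 4) 6 0 p) |>.add
      (hasGrad_monomial (1 / 2 * η) 6 2 p) |>.add
      (hasGrad_monomial (5 / 16 * η) 8 0 p) |>.add
      (hasGrad_monomial (-1 / 10 * η ^ 2) 10 0 p)) ?_ ?_ <;>
    simp only [secondCorrectionX, secondCorrectionY] <;> push_cast <;> ring

theorem hasGrad_thirdCorrection (η : ℝ) (p : ℝ × ℝ) :
    HasGrad (fun q => thirdCorrection η q.1 q.2) (thirdCorrectionX η p.1 p.2)
      (thirdCorrectionY η p.1 p.2) p := by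
  refine HasGrad.congr ((hasGrad_monomial (-135 / 64 * η ^ 3) 1 1 p) |>.add
      (hasGrad_monomial (-1233 / 256 * η ^ 3) 1 3 p) |>.add
      (hasGrad_monomial (24 / 35 - 45 / 14 * η - 4455 / 512 * η ^ 3) 1 5 p) |>.add
      (hasGrad_monomial (-765 / 512 * η ^ 3) 1 7 p) |>.add
      (hasGrad_monomial (135 / 512 * η ^ 3) 1 9 p) |>.add
      (hasGrad_monomial (-9 / 512 * η ^ 3) 1 11 p) |>.add
      (hasGrad_monomial (1233 / 256 * η ^ 3) 3 1 p) |>.add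
      (hasGrad_monomial (8 / 7 - 75 / 14 * η - 675 / 64 * η ^ 3) 3 3 p) |>.add
      (hasGrad_monomial (-2 * η - 2805 / 512 * η ^ 3) 3 5 p) |>.add
      (hasGrad_monomial (315 / 256 * η ^ 3) 3 7 p) |>.add
      (hasGrad_monomial (-51 / 512 * η ^ 3) 3 9 p) |>.add
      (hasGrad_monomial (-2025 / 512 * η ^ 3) 5 1 p) |>.add
      (hasGrad_monomial (17 / 14 * η + 45 / 14 * η ^ 2 - 3723 / 512 * η ^ 3) 5 3 p) |>.add
      (hasGrad_monomial (9 / 4 * η ^ 3) 5 5 p) |>.add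
      (hasGrad_monomial (-297 / 1280 * η ^ 3) 5 7 p) |>.add
      (hasGrad_monomial (765 / 512 * η ^ 3) 7 1 p) |>.add
      (hasGrad_monomial (-9 / 7 * η ^ 2 + 3555 / 1792 * η ^ 3) 7 3 p) |>.add
      (hasGrad_monomial (-2529 / 8960 * η ^ 3) 7 5 p) |>.add
      (hasGrad_monomial (-135 / 512 * η ^ 3) 9 1 p) |>.add
      (hasGrad_monomial (-667 / 3584 * η ^ 3) 9 3 p) |>.add
      (hasGrad_monomial (9 / 512 * η ^ 3) 11 1 p)) ?_ ?_ <;>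
    simp only [thirdCorrectionX, thirdCorrectionY] <;> push_cast <;> ring

/-- The right side is odd in `x`, so its mean over each oval of the undamped system vanishes; here
it even has a polynomial primitive along the field. -/
theorem secondCorrection_identity (η x y : ℝ) :
    secondCorrectionX η x y * y + secondCorrectionY η x y * (-x + η * x ^ 3)
      = 3 * x * y ^ 3 * exactDamping η x y := by
  simp only [secondCorrectionX, secondCorrectionY, exactDamping]
  ring

/-- The first two terms are the effect of the unfolding damping and the third-order effect of the
exact one. Up to derivatives along the undamped field, they cancel below order η³, and at that order
only a function of x² + y² is left. Its u⁶ term needs degree 12 in (x, y), which first occurs here,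
as η³x¹⁰y² in the second term. -/
theorem thirdCorrection_identity (η x y : ℝ) :
    unfoldingDamping η x y * y ^ 2 + η * secondCorrectionY η x y * exactDamping η x y * y
      + thirdCorrectionX η x y * y + thirdCorrectionY η x y * (-x + η * x ^ 3)
      = η ^ 3 * averagedRate (x ^ 2 + y ^ 2) + η ^ 4 * averagingRemainder x y := by
  simp only [secondCorrectionY, thirdCorrectionX, thirdCorrectionY, exactDamping,
    unfoldingDamping, averagedRate, averagingRemainder]
  ring

/-- The perturbation of the harmonic oscillator in the rescaled system, divided by `η`. -/
noncomputable def rescaledForce (η : ℝ) (p : ℝ × ℝ) : ℝ :=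
  p.1 ^ 3 + (η ^ 3 * exactDamping η p.1 p.2 + η ^ 10 * unfoldingDamping η p.1 p.2) * p.2

/-- The energy of the rescaled system with its corrections. -/
noncomputable def correctedEnergy (η : ℝ) (p : ℝ × ℝ) : ℝ :=
  (1 / 2) * p.1 ^ 2 * p.2 ^ 0 + (1 / 2) * p.1 ^ 0 * p.2 ^ 2 + (-(η / 4)) * p.1 ^ 4 * p.2 ^ 0
    + (-η ^ 4) * p.1 ^ 1 * p.2 ^ 3 + η ^ 8 * secondCorrection η p.1 p.2
    + η ^ 11 * thirdCorrection η p.1 p.2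

/-- The remainder in the derivative of `correctedEnergy` along the rescaled system. -/
noncomputable def energyRemainder (η : ℝ) (p : ℝ × ℝ) : ℝ :=
  averagingRemainder p.1 p.2 - 3 * p.1 * p.2 ^ 3 * unfoldingDamping η p.1 p.2
    + η ^ 4 * secondCorrectionY η p.1 p.2 * unfoldingDamping η p.1 p.2 * p.2
    + thirdCorrectionY η p.1 p.2 * exactDamping η p.1 p.2 * p.2
    + η ^ 7 * thirdCorrectionY η p.1 p.2 * unfoldingDamping η p.1 p.2 * p.2

theorem contDiff_rescaledForce :
    ContDiff ℝ 1 fun q : ℝ × ℝ × ℝ => rescaledForce q.1 q.2 := by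
  simp only [rescaledForce, exactDamping, unfoldingDamping]
  fun_prop

theorem contDiff_correctedEnergy :
    ContDiff ℝ 1 fun q : ℝ × ℝ × ℝ => correctedEnergy q.1 q.2 := by
  simp only [correctedEnergy, secondCorrection, thirdCorrection]
  fun_prop

theorem contDiff_energyRemainder :
    ContDiff ℝ 1 fun q : ℝ × ℝ × ℝ => energyRemainder q.1 q.2 := by
  simp only [energyRemainder, averagingRemainder, exactDamping, unfoldingDamping,
    secondCorrectionY, thirdCorrectionY]
  fun_prop

/-- The term -η⁴xy³ removes η⁴Dy² and creates -3η⁸xy³D, which the second correction removes. What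
remains is η¹¹ times the left side of `thirdCorrection_identity`, together with cross terms of order
η¹⁵ or higher. -/
theorem correctedEnergy_derivative (η : ℝ) (p : ℝ × ℝ) :
    ∃ V' : ℝ × ℝ →L[ℝ] ℝ, HasFDerivAt (correctedEnergy η) V' p ∧
      V' (oscField (fun p => η * rescaledForce η p) p)
        = η ^ 14 * (averagedRate (p.1 ^ 2 + p.2 ^ 2) + η * energyRemainder η p) := by
  refine ⟨_, ((((((hasGrad_monomial (1 / 2) 2 0 p).add (hasGrad_monomial (1 / 2) 0 2 p)).add
    (hasGrad_monomial (-(η / 4)) 4 0 p)).add (hasGrad_monomial (-η ^ 4) 1 3 p)).add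
    ((hasGrad_secondCorrection η p).const_mul (η ^ 8))).add
    ((hasGrad_thirdCorrection η p).const_mul (η ^ 11))), ?_⟩
  have h2 := secondCorrection_identity η p.1 p.2
  have h3 := thirdCorrection_identity η p.1 p.2
  simp only [oscField, rescaledForce, energyRemainder, add_apply,
    smul_apply, ContinuousLinearMap.coe_fst', ContinuousLinearMap.coe_snd',
    smul_eq_mul]
  push_cast
  generalize secondCorrectionX η p.1 p.2 = Wx at *
  generalize secondCorrectionY η p.1 p.2 = Wy at *
  generalize thirdCorrectionX η p.1 p.2 = Ux at *
  generalize thirdCorrectionY η p.1 p.2 = Uy at *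
  generalize unfoldingDamping η p.1 p.2 = P at *
  generalize averagedRate (p.1 ^ 2 + p.2 ^ 2) = F at *
  generalize averagingRemainder p.1 p.2 = R at *
  simp only [exactDamping] at *
  linear_combination η ^ 8 * h2 + η ^ 11 * h3

theorem hasDerivAt_averagedRate (u : ℝ) : HasDerivAt averagedRate
    (-(9 / 512) * (6 * u ^ 5 - 75 * u ^ 4 + 340 * u ^ 3 - 675 * u ^ 2 + 548 * u - 120)) u := by
  have h := fun n : ℕ => hasDerivAt_pow n u
  refine (((((((h 6).sub ((h 5).const_mul 15)).add ((h 4).const_mul 85)).sub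
    ((h 3).const_mul 225)).add ((h 2).const_mul 274)).sub
    ((hasDerivAt_id u).const_mul 120)).const_mul (-(9 / 512))).congr_deriv ?_
  push_cast
  ring

/-! ### Limit cycles of the rescaled system. -/

theorem eventually_exists_isLimitCycle_rescaled {u : ℝ} (hu : 0 < u) (h0 : averagedRate u = 0)
    (h1 : deriv averagedRate u ≠ 0) :
    ∀ᶠ η in 𝓝[>] (0 : ℝ), ∃ Γ, IsLimitCycle (oscField fun p => η * rescaledForce η p) Γ ∧
      ∀ p ∈ Γ, |p.1 ^ 2 + p.2 ^ 2 - u| < 1 / 2 := by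
  have hexp : exp (Real.log u / 2) ^ 2 = u := by
    rw [← Real.exp_nat_mul]
    push_cast
    rw [mul_div_cancel₀ _ (two_ne_zero), Real.exp_log hu]
  obtain ⟨δ, hδ, hδu⟩ : ∃ δ > 0, ∀ ρ ∈ Ioo (Real.log u / 2 - δ) (Real.log u / 2 + δ),
      |exp ρ ^ 2 - u| < 1 / 2 := by
    have hc : Continuous fun ρ : ℝ => |exp ρ ^ 2 - u| := by fun_prop
    have h : ∀ᶠ ρ in 𝓝 (Real.log u / 2), |exp ρ ^ 2 - u| < 1 / 2 :=
      hc.continuousAt.eventually_mem (Iio_mem_nhds (by rw [hexp]; norm_num))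
    obtain ⟨δ, hδ, h⟩ := Metric.eventually_nhds_iff_ball.1 h
    exact ⟨δ, hδ, fun ρ hρ => h ρ (by rwa [Real.ball_eq_Ioo])⟩
  have hFs : ContDiff ℝ 1 averagedRate := by
    unfold averagedRate
    fun_prop
  have hV0 : ∀ p, correctedEnergy 0 p = (p.1 ^ 2 + p.2 ^ 2) / 2 := fun p => by
    simp [correctedEnergy]
    ring
  -- The derivative at the zero may have either sign; replacing the rate by `σ` times itself, and
  -- the prefactor η¹⁴ by σ⁻¹η¹⁴, makes it positive.
  have key : ∀ σ : ℝ, σ ≠ 0 → 0 < σ * deriv averagedRate u →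
      ∀ᶠ η in 𝓝[>] (0 : ℝ), ∃ Γ, IsLimitCycle (oscField fun p => η * rescaledForce η p) Γ ∧
        ∀ p ∈ Γ, |p.1 ^ 2 + p.2 ^ 2 - u| < 1 / 2 := by
    intro σ hσ hpos
    have := eventually_exists_isLimitCycle (E := rescaledForce) (V := correctedEnergy)
      (R := fun η p => σ * energyRemainder η p) (F := fun u => σ * averagedRate u)
      (a := fun η => σ⁻¹ * η ^ 14) contDiff_rescaledForce
      (contDiff_const.mul contDiff_energyRemainder) contDiff_correctedEnergy
      (contDiff_const.mul hFs) hV0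
      (fun η hη => mul_ne_zero (inv_ne_zero hσ) (pow_ne_zero _ hη.ne'))
      (fun η p => by
        obtain ⟨V', hd, hv⟩ := correctedEnergy_derivative η p
        refine ⟨V', hd, hv.trans ?_⟩
        field_simp)
      hδ (by rw [hexp, h0, mul_zero])
      (by
        rw [hexp, ((hasDerivAt_averagedRate u).const_mul σ).deriv,
          ← (hasDerivAt_averagedRate u).deriv]
        exact hpos)
    refine this.mono fun η ⟨Γ, hΓ, hmem⟩ => ⟨Γ, hΓ, fun p hp => ?_⟩
    obtain ⟨θ, ρ, hρ, rfl⟩ := hmem p hp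
    rw [polarPt_sq]
    exact hδu ρ hρ
  rcases lt_or_gt_of_ne h1 with h | h
  · exact key (-1) (by norm_num) (by linarith)
  · exact key 1 one_ne_zero (by linarith)

/-! ### Return to the original system by scaling. -/

section Scaling

variable {X Z : ℝ × ℝ → ℝ × ℝ} {k : ℝ}

theorem IsPeriodicOrbit.image_smul (hk : k ≠ 0) (hXZ : ∀ p, X (k • p) = k • Z p)
    {Γ : Set (ℝ × ℝ)} (h : IsPeriodicOrbit Z Γ) : IsPeriodicOrbit X ((k • ·) '' Γ) := by
  obtain ⟨γ, T, hT, hγ, hper, ⟨t, ht⟩, rfl⟩ := h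
  refine ⟨fun t => k • γ t, T, hT, fun t => ?_, fun t => ?_, ⟨t, fun h => ?_⟩, ?_⟩
  · simp only [hXZ]
    exact (hγ t).const_smul k
  · simp only [hper t]
  · exact ht (smul_right_injective _ hk h)
  · rw [← range_comp]
    rfl

theorem IsLimitCycle.image_smul (hk : k ≠ 0) (hXZ : ∀ p, X (k • p) = k • Z p)
    {Γ : Set (ℝ × ℝ)} (h : IsLimitCycle Z Γ) : IsLimitCycle X ((k • ·) '' Γ) := by
  obtain ⟨hΓ, U, hU, hΓU, huniq⟩ := h
  have hinv : ∀ p, Z (k⁻¹ • p) = k⁻¹ • X p := fun p => by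
    rw [eq_inv_smul_iff₀ hk, ← hXZ, smul_inv_smul₀ hk]
  refine ⟨hΓ.image_smul hk hXZ, (k • ·) '' U, isOpenMap_smul₀ hk U hU, image_mono hΓU,
    fun Γ' hΓ' hsub => ?_⟩
  have h1 := huniq ((k⁻¹ • ·) '' Γ') (hΓ'.image_smul (inv_ne_zero hk) hinv) (by
    rintro _ ⟨p, hp, rfl⟩
    obtain ⟨q, hq, rfl⟩ := hsub hp
    simpa only [inv_smul_smul₀ hk] using hq)
  rw [← h1, image_image]
  simp only [smul_inv_smul₀ hk, image_id']

end Scaling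

/-- The coefficients of the system whose rescaling by `√(η / c)` is
`oscField fun p => η * rescaledForce η p`, where `c` is the coefficient of `x³`. -/
noncomputable def unfoldingCoeff (c ε η : ℝ) : Fin 6 → ℝ :=
  ![c ^ 2 * (3 * η ^ 3 + η ^ 9 * (24 / 7 - 225 / 14 * η)) / ε,
    c * (-3 * η ^ 3 + η ^ 10 * (-1233 / 32 * η ^ 3)) / ε,
    η ^ 11 * (135 / 32 * η ^ 3) / ε,
    c * η ^ 3 / ε,
    c ^ 3 * η ^ 8 * (-30 / 7 * η + 180 / 7 * η ^ 2 - 153 / 4 * η ^ 3) / ε,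
    c ^ 2 * η ^ 9 * (-24 / 35 + 45 / 14 * η + 405 / 32 * η ^ 3) / ε]

/-- Every coefficient keeps a positive power of `η` after the scaling is undone. -/
theorem tendsto_unfoldingCoeff (c ε : ℝ) :
    Tendsto (unfoldingCoeff c ε) (𝓝 0) (𝓝 0) := by
  have hc : Continuous (unfoldingCoeff c ε) := by
    refine continuous_pi fun i => ?_
    fin_cases i <;> simp only [unfoldingCoeff] <;> simp <;> fun_prop
  have h0 : unfoldingCoeff c ε 0 = 0 := by
    ext i
    fin_cases i <;> simp [unfoldingCoeff]
  simpa only [h0] using hc.tendsto 0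

theorem rayleighLienardField_smul {a b ε η k : ℝ} (hε : ε ≠ 0)
    (hk : -2 * b / a ^ 2 * k ^ 2 = η) (p : ℝ × ℝ) :
    rayleighLienardField a b ε (unfoldingCoeff (-2 * b / a ^ 2) ε η) (k • p)
      = k • oscField (fun p => η * rescaledForce η p) p := by
  have hc : 2 * b / a ^ 2 = -(-2 * b / a ^ 2) := by ring
  simp only [rayleighLienardField, hc]
  generalize -2 * b / a ^ 2 = c at *
  subst hk
  ext
  · simp [oscField]
  · simp only [oscField, rescaledForce, exactDamping, unfoldingDamping, unfoldingCoeff,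
      Prod.smul_fst, Prod.smul_snd, smul_eq_mul]
    simp
    field_simp
    ring

theorem mainTheorem2 (a b ε : ℝ) (ha : 0 < a) (hb : b < 0) (hε : ε ≠ 0) :
    LimitCyclesBifurcate (fun d : Fin 6 → ℝ => rayleighLienardField a b ε d)
      (0 : Fin 6 → ℝ) ((0, 0) : ℝ × ℝ) 5 := by
  intro U hU W hW
  obtain ⟨c, hcdef⟩ : ∃ c, c = -2 * b / a ^ 2 := ⟨_, rfl⟩
  have hc : 0 < c := by
    rw [hcdef]
    exact div_pos (by linarith) (by positivity)
  obtain ⟨r, hr, hrU⟩ := Metric.mem_nhds_iff.1 hU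
  -- The shift `i + 1` skips the zero u = 0, which is the equilibrium. Bands of half-width 1/2
  -- around distinct integers are disjoint, which later separates the cycles.
  have hcycles : ∀ᶠ η in 𝓝[>] (0 : ℝ), ∀ i : Fin 5, ∃ Γ,
      IsLimitCycle (oscField fun p => η * rescaledForce η p) Γ ∧
        ∀ p ∈ Γ, |p.1 ^ 2 + p.2 ^ 2 - ((i : ℕ) + 1)| < 1 / 2 := by
    refine eventually_all.2 fun i => eventually_exists_isLimitCycle_rescaled (by positivity) ?_ ?_
    · fin_cases i <;> norm_num [averagedRate]
    · rw [(hasDerivAt_averagedRate _).deriv]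
      fin_cases i <;> norm_num
  -- On every cycle x² + y² < 5 + 1/2 < 9, so 3 bounds the sup norm before scaling.
  have hsmall : ∀ᶠ η in 𝓝[>] (0 : ℝ), 3 * √(η / c) < r := by
    have h : Continuous fun η : ℝ => 3 * √(η / c) := by fun_prop
    exact nhdsWithin_le_nhds (h.continuousAt.eventually_mem (Iio_mem_nhds (by simpa using hr)))
  have hparam : ∀ᶠ η in 𝓝[>] (0 : ℝ), unfoldingCoeff c ε η ∈ W :=
    nhdsWithin_le_nhds ((tendsto_unfoldingCoeff c ε).eventually_mem hW)
  obtain ⟨η, hΓ, hηr, hηW, hη⟩ :=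
    (hcycles.and (hsmall.and (hparam.and self_mem_nhdsWithin))).exists
  choose Γ hcyc hmem using hΓ
  set k := √(η / c) with hkdef
  have hk : 0 < k := Real.sqrt_pos.2 (div_pos hη hc)
  have hk2 : -2 * b / a ^ 2 * k ^ 2 = η := by
    rw [← hcdef, hkdef, Real.sq_sqrt (div_pos hη hc).le]
    field_simp
  refine ⟨unfoldingCoeff c ε η, hηW, ?_⟩
  have hinj : Injective fun i => (k • ·) '' Γ i := by
    intro i j hij
    have hij' : Γ i = Γ j := (smul_right_injective (ℝ × ℝ) hk.ne').image_injective hij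
    obtain ⟨γ, -, -, -, -, -, hγ⟩ := (hcyc i).1
    have hp : γ 0 ∈ Γ i := hγ ▸ mem_range_self 0
    have h1 := abs_lt.1 (hmem i _ hp)
    have h2 := abs_lt.1 (hmem j _ (hij' ▸ hp))
    have h3 : ((i : ℕ) : ℝ) < (j : ℕ) + 1 := by linarith [h1.1, h2.2]
    have h4 : ((j : ℕ) : ℝ) < (i : ℕ) + 1 := by linarith [h1.2, h2.1]
    norm_cast at h3 h4
    omega
  have hcard : (range fun i => (k • ·) '' Γ i).encard = 5 := by
    rw [← image_univ, hinj.encard_image]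
    simp
  rw [Nat.cast_ofNat, ← hcard]
  refine encard_le_encard ?_
  rintro _ ⟨i, rfl⟩
  refine ⟨(hcyc i).image_smul hk.ne' fun p => ?_, ?_⟩
  · rw [hcdef]
    exact rayleighLienardField_smul hε hk2 p
  · rintro _ ⟨p, hp, rfl⟩
    refine hrU ?_
    have hi : ((i : ℕ) : ℝ) + 1 ≤ 5 := by
      have := i.2
      exact_mod_cast this
    have hp2 := (abs_lt.1 (hmem i p hp)).2
    have h1 : |p.1| < 3 := abs_lt_of_sq_lt_sq (by nlinarith [sq_nonneg p.2]) (by norm_num)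
    have h2 : |p.2| < 3 := abs_lt_of_sq_lt_sq (by nlinarith [sq_nonneg p.1]) (by norm_num)
    have hnorm : ‖p‖ ≤ 3 := by
      rw [Prod.norm_def, Real.norm_eq_abs, Real.norm_eq_abs]
      exact max_le h1.le h2.le
    rw [show ((0, 0) : ℝ × ℝ) = 0 from rfl, mem_ball_zero_iff]
    simp only [norm_smul, Real.norm_eq_abs, abs_of_pos hk]
    nlinarith
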